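/- **Theorem (saddle point approximation for a one-parameter family).** For $y\in[0,1]$ let $D_y\subseteq\mathbb C$ be open and let $\Phi_y:D_y\to\mathbb C$ be holomorphic, depending smoothly on $y$; that is, $\{(y,z): y\in[0,1],\ z\in D_y\}$ is relatively open in $[0,1]\times\mathbb C$ and $(y,z)\mapsto\Phi_y(z)$ is $C^\infty$ on it. Let $C:[0,1]^2\to\mathbb C$, $(y,t)\mapsto C(y,t)$, be continuous and such that for every $y$ the curve $C_y=C(y,\cdot)$ is a contour (a piecewise $C^1$ curve) contained in $D_y$, of length at most $L$, where $L$ is independent of $y$. Suppose that for each $y\in[0,1]$ the contour $C_y$ contains exactly one saddle point $z_y$ of $\Phi_y$ (that is, $z_y$ is the only point $z$ of $C_y$ with $\Phi_y'(z)=0$), and that the maximum of $\operatorname{Re}\Phi_y$ along $C_y$ is attained at $z_y$. Suppose moreover that: 1. either $C(y,0)=C(y,1)$ for every $y\in[0,1]$ (the contours are loops), or $\operatorname{Re}\Phi_0(C(0,0))<\operatorname{Re}\Phi_0(z_0)$ and $\operatorname{Re}\Phi_0(C(0,1))<\operatorname{Re}\Phi_0(z_0)$; 2. $C_0$ passes through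 $z_0$ exactly once and from left to right: there is $t_0\in(0,1)$ with $C(0,t_0)=z_0$, $C(0,t)\ne z_0$ for all $t\neq t_0$, and $\operatorname{Re}C(0,t)<\operatorname{Re}z_0$ for $t<t_0$ close to $t_0$, $\operatorname{Re}C(0,t)>\operatorname{Re}z_0$ for $t>t_0$ close to $t_0$; 3. $\Phi_0''(z_0)\neq0$ and $\bigl|\arg\sqrt{-\Phi_0''(z_0)}\bigr|<\pi/4$, where $\sqrt{\cdot}$ is the principal square root and $\arg$ the principal argument. Then for every sequence $(y_N)_{N\in\mathbb N}$ in $[0,1]$ with $y_N\to0$ there are numbers $E_N\in\mathbb C$ with $E_N=O(1/N)$ as $N\to\infty$ such that, for all sufficiently large $N$, $\Phi_{y_N}''(z_{y_N})\ne0$ and $$\int_{C_{y_N}}e^{N\Phi_{y_N}(z)}\,dz=\sqrt{\frac{2\pi}{N\bigl(-\Phi_{y_N}''(z_{y_N})\bigr)}}\;e^{N\Phi_{y_N}(z_{y_N})}\,(1+E_N),$$ with the principal square root. -/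

import Mathlib

open Set Filter Topology Asymptotics
open scoped ContDiff

noncomputable section

namespace SaddlePoint

/-- A family `Φ y`, `y ∈ [0,1]`, of holomorphic functions with open domains `D y ⊆ ℂ`, depending
smoothly on `y`: the total space `{(y, z) | y ∈ [0,1], z ∈ D y}` is relatively open in
`[0,1] × ℂ`, each `Φ y` is holomorphic on `D y`, and `(y, z) ↦ Φ y z` is `C^∞` (in the real sense,
one-sided in `y` at `y = 0, 1`) on the total space. -/
structure IsSmoothHolomorphicFamily (D : ℝ → Set ℂ) (Φ : ℝ → ℂ → ℂ) : Prop where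
  relatively_open : ∃ O : Set (ℝ × ℂ), IsOpen O ∧
    ∀ y ∈ Icc (0 : ℝ) 1, ∀ z : ℂ, z ∈ D y ↔ (y, z) ∈ O
  holomorphic : ∀ y ∈ Icc (0 : ℝ) 1, DifferentiableOn ℂ (Φ y) (D y)
  smooth : ContDiffOn ℝ ∞ (fun p : ℝ × ℂ => Φ p.1 p.2)
    {p : ℝ × ℂ | p.1 ∈ Icc (0 : ℝ) 1 ∧ p.2 ∈ D p.1}

/-- A contour: a piecewise `C^1` curve parametrized by `[0,1]` (continuously differentiable up to
the endpoints on each of finitely many closed intervals that make up `[0,1]`). -/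
def IsContour (γ : ℝ → ℂ) : Prop :=
  ∃ (n : ℕ) (p : ℕ → ℝ), Monotone p ∧ p 0 = 0 ∧ p n = 1 ∧
    ∀ i < n, ContDiffOn ℝ 1 γ (Icc (p i) (p (i + 1)))

/-- The length of a contour. -/
def contourLength (γ : ℝ → ℂ) : ℝ := ∫ t in (0 : ℝ)..1, ‖deriv γ t‖

/-- The contour integral `∫_γ f(z) dz`. -/
def contourIntegral (f : ℂ → ℂ) (γ : ℝ → ℂ) : ℂ := ∫ t in (0 : ℝ)..1, f (γ t) * deriv γ t

/-- The curve `γ : [0,1] → ℂ` passes through the point `z` exactly once, at an interior time, and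
does so from the left (`Re < Re z`) to the right (`Re > Re z`). -/
def PassesOnceLeftToRight (γ : ℝ → ℂ) (z : ℂ) : Prop :=
  ∃ t₀ ∈ Ioo (0 : ℝ) 1, γ t₀ = z ∧ (∀ t ∈ Icc (0 : ℝ) 1, γ t = z → t = t₀) ∧
    (∀ᶠ t in 𝓝[<] t₀, (γ t).re < z.re) ∧ (∀ᶠ t in 𝓝[>] t₀, z.re < (γ t).re)

end SaddlePoint

end

/-! Let b = √(-Φ''(z)) at the saddle point z. On a short segment through z in the direction 1/b the
exponent is Φ(z) - u²/2 + c u³ + O(u⁴), which yields the main term. The rest of the contour can be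
pushed into {Re Φ < Re Φ(z)}, where it contributes exponentially little. The deformation is chosen
for y = 0 and carried over to nearby y by uniform convergence, so that all constants are uniform.

The push is a single explicit gradient step w ↦ w - s·conj(Φ₀'(w)). It strictly lowers Re Φ₀
wherever Φ₀' ≠ 0, that is, on all of `C 0` except at the saddle point (`re_descentStep_le`). The
step is short, so the old and the new curve can be compared piece by piece in disks, where
primitives exist (`exponentiallySmall_deformedIntegral`).

Between a time just before and a time just after the passage the curve lies in one disk, so only its
two ends matter. Their descent images lie in the double sector Re (b(w - z))² > 0. Since |arg b| <
π/4, the passage from left to right puts one image in the left half and the other in the right half.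
Half sectors are convex, so segments below the saddle value join these images to z ∓ δ/b
(`exists_segment_below_saddle`).

On the segment between these two points Laplace's method applies. The cubic term is odd and
integrates to zero, which makes the relative error O(1/N) (`exists_laplace_bound`,
`exists_central_bound`). `exists_saddle_point_bound` assembles the pieces; the theorem then needs
only the convergence of the derivatives, of the saddle points and of the square roots. -/

/-! ### Taylor expansions with uniform constants. -/

open Metric in
/-- First-order factorization of a bounded holomorphic function on a disk. -/
theorem exists_bounded_factor {f : ℂ → ℂ} {z : ℂ} {R B : ℝ} (hR : 0 < R)
    (hf : DifferentiableOn ℂ f (ball z R)) (hB : ∀ w ∈ ball z R, ‖f w‖ ≤ B) :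
    ∃ q : ℂ → ℂ, DifferentiableOn ℂ q (ball z R) ∧ (∀ w, f w = f z + (w - z) * q w) ∧
      q z = deriv f z ∧ ∀ w ∈ ball z R, ‖q w‖ ≤ 2 * B / R := by
  refine ⟨dslope f z, ?_, fun w => ?_, dslope_same f z, fun w hw => ?_⟩
  · exact (Complex.differentiableOn_dslope (ball_mem_nhds z hR)).2 hf
  · have := sub_smul_dslope f z w
    rw [smul_eq_mul] at this
    rw [this]; ring
  -- Schwarz lemma: `f` maps the disk into the closed disk of radius 2B about `f z`.
  · refine Complex.norm_dslope_le_div_of_mapsTo_ball hf (fun v hv => ?_) hw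
    rw [mem_closedBall, dist_eq_norm]
    have h1 := hB v hv
    have h2 := hB z (mem_ball_self hR)
    linarith [norm_sub_le (f v) (f z)]

open Metric in
/-- Taylor expansions at the centre of a disk on which a holomorphic function is bounded, with
constants that depend only on the radius and the bound. -/
theorem exists_uniform_taylor {R : ℝ} (B : ℝ) (hR : 0 < R) :
    ∃ K : ℝ, 0 < K ∧ ∀ (f : ℂ → ℂ) (z : ℂ), DifferentiableOn ℂ f (ball z R) →
      (∀ w ∈ ball z R, ‖f w‖ ≤ B) →
      ‖deriv f z‖ ≤ K ∧
      (∀ w ∈ ball z R, ‖f w - f z - deriv f z * (w - z)‖ ≤ K * ‖w - z‖ ^ 2) ∧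
      ∃ c : ℂ, ‖c‖ ≤ K ∧ ∀ w ∈ ball z R,
        ‖f w - f z - deriv f z * (w - z) - deriv (deriv f) z / 2 * (w - z) ^ 2
          - c * (w - z) ^ 3‖ ≤ K * ‖w - z‖ ^ 4 := by
  set B₁ := 2 * B / R
  set B₂ := 2 * B₁ / R
  set B₃ := 2 * B₂ / R
  set B₄ := 2 * B₃ / R
  refine ⟨|B₁| + |B₂| + |B₃| + |B₄| + 1, by positivity, fun f z hf hB => ?_⟩
  -- Dividing by w - z four times; each division multiplies the bound by 2/R.
  obtain ⟨q₁, d₁, e₁, v₁, b₁⟩ := exists_bounded_factor hR hf hB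
  obtain ⟨q₂, d₂, e₂, v₂, b₂⟩ := exists_bounded_factor hR d₁ b₁
  obtain ⟨q₃, d₃, e₃, v₃, b₃⟩ := exists_bounded_factor hR d₂ b₂
  obtain ⟨q₄, d₄, e₄, v₄, b₄⟩ := exists_bounded_factor hR d₃ b₃
  have hz : z ∈ ball z R := mem_ball_self hR
  have hq₂ : deriv (deriv f) z / 2 = q₂ z := by
    have h1 : deriv f =ᶠ[𝓝 z] fun w => q₁ w + (w - z) * deriv q₁ w := by
      filter_upwards [isOpen_ball.mem_nhds hz] with w hw
      have hd := (d₁.differentiableAt (isOpen_ball.mem_nhds hw)).hasDerivAt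
      have h2 : HasDerivAt (fun w => f z + (w - z) * q₁ w)
          (1 * q₁ w + (w - z) * deriv q₁ w) w :=
        (((hasDerivAt_id w).sub_const z).mul hd).const_add (f z)
      rw [show f = fun w => f z + (w - z) * q₁ w from funext e₁, h2.deriv, one_mul]
    have hd := (d₁.differentiableAt (isOpen_ball.mem_nhds hz)).hasDerivAt
    have hdd := ((d₁.deriv isOpen_ball).differentiableAt (isOpen_ball.mem_nhds hz)).hasDerivAt
    have h3 : HasDerivAt (fun w => q₁ w + (w - z) * deriv q₁ w)
        (deriv q₁ z + (1 * deriv q₁ z + (z - z) * deriv (deriv q₁) z)) z :=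
      hd.add (((hasDerivAt_id z).sub_const z).mul hdd)
    rw [h1.deriv_eq, h3.deriv, v₂]; ring
  refine ⟨?_, fun w hw => ?_, q₃ z, ?_, fun w hw => ?_⟩
  · rw [← v₁]
    have := b₁ z hz
    linarith [le_abs_self B₁, abs_nonneg B₂, abs_nonneg B₃, abs_nonneg B₄]
  · have h : f w - f z - deriv f z * (w - z) = q₂ w * (w - z) ^ 2 := by
      rw [e₁ w, e₂ w, ← v₁]; ring
    rw [h, norm_mul, norm_pow]
    gcongr
    have := b₂ w hw
    linarith [le_abs_self B₂, abs_nonneg B₁, abs_nonneg B₃, abs_nonneg B₄]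
  · have := b₃ z hz
    linarith [le_abs_self B₃, abs_nonneg B₁, abs_nonneg B₂, abs_nonneg B₄]
  · have h : f w - f z - deriv f z * (w - z) - deriv (deriv f) z / 2 * (w - z) ^ 2
          - q₃ z * (w - z) ^ 3 = q₄ w * (w - z) ^ 4 := by
      rw [e₁ w, e₂ w, e₃ w, e₄ w, ← v₁, hq₂]; ring
    rw [h, norm_mul, norm_pow]
    gcongr
    have := b₄ w hw
    linarith [le_abs_self B₄, abs_nonneg B₁, abs_nonneg B₂, abs_nonneg B₃]

/-! ### Integrals along segments and contours. -/

/-- The integral of `g` along the segment from `a` to `b`. -/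
noncomputable def segmentIntegral (g : ℂ → ℂ) (a b : ℂ) : ℂ :=
  ∫ s in (0 : ℝ)..1, g (a + s * (b - a)) * (b - a)

theorem add_ofReal_mul_sub_mem {B : Set ℂ} (hB : Convex ℝ B) {a b : ℂ} (ha : a ∈ B) (hb : b ∈ B)
    {s : ℝ} (hs : s ∈ Icc (0 : ℝ) 1) : a + s * (b - a) ∈ B := by
  have := hB.add_smul_sub_mem ha hb hs
  rwa [Complex.real_smul] at this

theorem segmentIntegral_eq_sub {g G : ℂ → ℂ} {B : Set ℂ} (hB : Convex ℝ B)
    (hG : ∀ w ∈ B, HasDerivAt G (g w) w) (hg : ContinuousOn g B) {a b : ℂ}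
    (ha : a ∈ B) (hb : b ∈ B) : segmentIntegral g a b = G b - G a := by
  have hu : uIcc (0 : ℝ) 1 = Icc 0 1 := uIcc_of_le zero_le_one
  have hc : ContinuousOn (fun s : ℝ => a + s * (b - a)) (Icc 0 1) := by fun_prop
  have h := intervalIntegral.integral_eq_sub_of_hasDerivAt (a := 0) (b := 1)
    (f := fun s : ℝ => G (a + s * (b - a))) (f' := fun s : ℝ => g (a + s * (b - a)) * (b - a))
    (fun s hs => ?_) ?_
  · rw [segmentIntegral, h]; simp
  · rw [hu] at hs
    have h1 : HasDerivAt (fun s : ℝ => a + s * (b - a)) (b - a) s := by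
      simpa using ((Complex.ofRealCLM.hasDerivAt (x := s)).mul_const (b - a)).const_add a
    exact (hG _ (add_ofReal_mul_sub_mem hB ha hb hs)).comp s h1
  · refine ContinuousOn.intervalIntegrable ?_
    rw [hu]
    exact (hg.comp hc fun s hs => add_ofReal_mul_sub_mem hB ha hb hs).mul continuousOn_const

theorem norm_segmentIntegral_le {g : ℂ → ℂ} {A : ℝ} {a b : ℂ}
    (hg : ∀ w ∈ segment ℝ a b, ‖g w‖ ≤ A) : ‖segmentIntegral g a b‖ ≤ A * ‖b - a‖ := by
  have := intervalIntegral.norm_integral_le_of_norm_le_const (a := 0) (b := 1)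
    (f := fun s : ℝ => g (a + s * (b - a)) * (b - a)) (C := A * ‖b - a‖) (fun s hs => ?_)
  · simpa [segmentIntegral] using this
  · rw [uIoc_of_le zero_le_one] at hs
    rw [norm_mul]
    gcongr
    exact hg _ (add_ofReal_mul_sub_mem (convex_segment a b) (left_mem_segment ℝ a b)
      (right_mem_segment ℝ a b) ⟨hs.1.le, hs.2⟩)

namespace SaddlePoint

theorem IsContour.continuousOn {γ : ℝ → ℂ} (h : IsContour γ) : ContinuousOn γ (Icc 0 1) := by
  obtain ⟨n, p, hp, h0, h1, hd⟩ := h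
  rw [← h0, ← h1]
  have key : ∀ m ≤ n, ContinuousOn γ (Icc (p 0) (p m)) := by
    intro m
    induction m with
    | zero => intro _; simp
    | succ k ih =>
      intro hk
      rw [← Icc_union_Icc_eq_Icc (hp k.zero_le) (hp k.le_succ)]
      exact (ih (by omega)).union_of_isClosed (hd k (by omega)).continuousOn isClosed_Icc isClosed_Icc
  exact key n le_rfl

theorem IsContour.exists_countable {γ : ℝ → ℂ} (h : IsContour γ) :
    ∃ S : Set ℝ, S.Countable ∧ ∀ t ∈ Icc (0 : ℝ) 1 \ S, DifferentiableAt ℝ γ t := by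
  obtain ⟨n, p, hp, h0, h1, hd⟩ := h
  refine ⟨range p, countable_range p, ?_⟩
  have key : ∀ m ≤ n, ∀ t ∈ Icc (p 0) (p m) \ range p, DifferentiableAt ℝ γ t := by
    intro m
    induction m with
    | zero =>
      rintro _ t ⟨ht, hts⟩
      exact absurd ⟨0, le_antisymm ht.1 ht.2⟩ hts
    | succ k ih =>
      rintro hk t ⟨ht, hts⟩
      rcases le_or_gt t (p k) with h | h
      · exact ih (by omega) t ⟨⟨ht.1, h⟩, hts⟩
      · have hlt : t < p (k + 1) := lt_of_le_of_ne ht.2 fun e => hts ⟨k + 1, e.symm⟩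
        exact ((hd k (by omega)).differentiableOn one_ne_zero).differentiableAt (Icc_mem_nhds h hlt)
  intro t ht
  refine key n le_rfl t ?_
  rwa [h0, h1]

/-- At break points `deriv` may take its default value, but these are a null set. Inside each piece
it agrees with the one-sided derivative, which is continuous up to the ends. -/
theorem IsContour.intervalIntegrable_deriv {γ : ℝ → ℂ} (h : IsContour γ) :
    IntervalIntegrable (deriv γ) MeasureTheory.volume 0 1 := by
  obtain ⟨n, p, hp, h0, h1, hd⟩ := h
  rw [← h0, ← h1]
  refine IntervalIntegrable.trans_iterate fun k hk => ?_
  rcases (hp k.le_succ).eq_or_lt with h | h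
  · rw [← h]
  · have hc := (hd k hk).continuousOn_derivWithin (uniqueDiffOn_Icc h) le_rfl
    rw [← uIcc_of_le h.le] at hc
    refine hc.intervalIntegrable.congr_ae ?_
    rw [uIoc_of_le h.le, ← MeasureTheory.restrict_Ioo_eq_restrict_Ioc, uIcc_of_le h.le]
    filter_upwards [MeasureTheory.ae_restrict_mem measurableSet_Ioo] with t ht
    exact derivWithin_of_mem_nhds (Icc_mem_nhds ht.1 ht.2)

theorem IsContour.intervalIntegrable_mul_deriv {γ : ℝ → ℂ} (h : IsContour γ) {g : ℂ → ℂ}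
    {a b : ℝ} (ha : 0 ≤ a) (hab : a ≤ b) (hb : b ≤ 1)
    (hg : ContinuousOn (fun t => g (γ t)) (Icc a b)) :
    IntervalIntegrable (fun t => g (γ t) * deriv γ t) MeasureTheory.volume a b := by
  have h1 : IntervalIntegrable (deriv γ) MeasureTheory.volume a b :=
    h.intervalIntegrable_deriv.mono_set (by
      rw [uIcc_of_le hab, uIcc_of_le zero_le_one]; exact Icc_subset_Icc ha hb)
  exact h1.continuousOn_mul (by rwa [uIcc_of_le hab])

/-- The fundamental theorem of calculus along a contour. -/
theorem IsContour.integral_eq_sub {γ : ℝ → ℂ} (h : IsContour γ) {g G : ℂ → ℂ} {B : Set ℂ}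
    {a b : ℝ} (ha : 0 ≤ a) (hab : a ≤ b) (hb : b ≤ 1) (hB : ∀ t ∈ Icc a b, γ t ∈ B)
    (hG : ∀ w ∈ B, HasDerivAt G (g w) w) (hg : ContinuousOn g B) :
    ∫ t in a..b, g (γ t) * deriv γ t = G (γ b) - G (γ a) := by
  obtain ⟨S, hS, hd⟩ := h.exists_countable
  have hsub : Icc a b ⊆ Icc 0 1 := Icc_subset_Icc ha hb
  have hγ := h.continuousOn.mono hsub
  refine MeasureTheory.integral_eq_of_hasDerivAt_off_countable_of_le (fun t => G (γ t)) _ hab hS ?_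
    (fun t ht => ?_) (h.intervalIntegrable_mul_deriv ha hab hb (hg.comp hγ hB))
  · have hGc : ContinuousOn G B := fun w hw => (hG w hw).continuousAt.continuousWithinAt
    exact hGc.comp hγ hB
  · have hm : t ∈ Icc a b := Ioo_subset_Icc_self ht.1
    exact (hG _ (hB t hm)).comp t (hd t ⟨hsub hm, ht.2⟩).hasDerivAt

end SaddlePoint

/-! ### Laplace's method on the real line. -/

theorem integral_cube_mul_exp_neg_sq (c : ℂ) (N δ : ℝ) :
    ∫ u in (-δ)..δ, (N : ℂ) * c * (u : ℂ) ^ 3 * Complex.exp (-(N * (u : ℂ) ^ 2 / 2)) = 0 := by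
  have h := intervalIntegral.integral_comp_neg (a := -δ) (b := δ)
    (fun u : ℝ => (N : ℂ) * c * (u : ℂ) ^ 3 * Complex.exp (-(N * (u : ℂ) ^ 2 / 2)))
  rw [neg_neg] at h
  have h2 : ∀ u : ℝ, (N : ℂ) * c * ((-u : ℝ) : ℂ) ^ 3 *
      Complex.exp (-(N * ((-u : ℝ) : ℂ) ^ 2 / 2)) =
      -((N : ℂ) * c * (u : ℂ) ^ 3 * Complex.exp (-(N * (u : ℂ) ^ 2 / 2))) := by
    intro u
    push_cast
    rw [neg_sq]; ring
  simp_rw [h2] at h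
  rw [intervalIntegral.integral_neg] at h
  exact CharZero.neg_eq_self_iff.1 h

/-- Pointwise comparison behind Laplace's method, near the maximum. -/
theorem norm_exp_sub_gaussian_le {K N u : ℝ} (hK : 0 < K) (hN : 1 ≤ N) (hu1 : |u| ≤ 1)
    (hu : 8 * K * |u| ≤ 1) {p c : ℂ} (hc : ‖c‖ ≤ K)
    (hp : ‖p + u ^ 2 / 2 - c * u ^ 3‖ ≤ K * u ^ 4) :
    ‖Complex.exp (N * p) - N * c * (u : ℂ) ^ 3 * Complex.exp (-(N * (u : ℂ) ^ 2 / 2))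
      - Complex.exp (-(N * (u : ℂ) ^ 2 / 2))‖
      ≤ (12288 * K ^ 2 + 128 * K) / N * Real.exp (-(N / 8) * u ^ 2) := by
  have hN0 : (0 : ℝ) < N := by linarith
  set v := N * u ^ 2 with hv
  have hv0 : 0 ≤ v := by positivity
  -- The exponent is -v/2 + x with |x| ≤ v/4. Expanding e^x to first order leaves x² and N R, both
  -- of the form (polynomial in v)/N.
  set x : ℂ := N * (p + u ^ 2 / 2) with hx
  set R : ℂ := p + u ^ 2 / 2 - c * u ^ 3 with hR
  have hexp : Complex.exp (N * p) = Complex.exp (-(N * (u : ℂ) ^ 2 / 2)) * Complex.exp x := by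
    rw [← Complex.exp_add, hx]; ring_nf
  have hid : Complex.exp (N * p) - N * c * (u : ℂ) ^ 3 * Complex.exp (-(N * (u : ℂ) ^ 2 / 2))
      - Complex.exp (-(N * (u : ℂ) ^ 2 / 2)) =
      Complex.exp (-(N * (u : ℂ) ^ 2 / 2)) * ((Complex.exp x - (1 + x)) + N * R) := by
    rw [hexp, hx, hR]; ring
  have hne : ‖Complex.exp (-(N * (u : ℂ) ^ 2 / 2))‖ = Real.exp (-v / 2) := by
    rw [show (-(N * (u : ℂ) ^ 2 / 2)) = ((-v / 2 : ℝ) : ℂ) by rw [hv]; push_cast; ring,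
      Complex.norm_exp_ofReal]
  have habs : |u| ^ 4 = u ^ 4 := by rw [← abs_pow]; exact abs_of_nonneg (by positivity)
  have habs2 : |u| ^ 2 = u ^ 2 := sq_abs u
  have hu4 : K * u ^ 4 ≤ K * |u| ^ 3 := by
    rw [← habs]
    exact mul_le_mul_of_nonneg_left (pow_le_pow_of_le_one (abs_nonneg u) hu1 (by norm_num)) hK.le
  have hx1 : ‖x‖ ≤ N * (2 * K * |u| ^ 3) := by
    rw [hx, norm_mul, Complex.norm_real, Real.norm_of_nonneg hN0.le]
    refine mul_le_mul_of_nonneg_left ?_ hN0.le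
    have h1 : p + (u : ℂ) ^ 2 / 2 = R + c * u ^ 3 := by rw [hR]; ring
    have h2 : ‖c * (u : ℂ) ^ 3‖ ≤ K * |u| ^ 3 := by
      rw [norm_mul, norm_pow, Complex.norm_real, Real.norm_eq_abs]
      gcongr
    rw [h1]
    linarith [norm_add_le R (c * u ^ 3)]
  have hx2 : ‖x‖ ≤ v / 4 := by
    refine hx1.trans ?_
    have : N * (2 * K * |u| ^ 3) = N * u ^ 2 * (8 * K * |u|) / 4 := by rw [← habs2]; ring
    rw [this, hv]
    have : N * u ^ 2 * (8 * K * |u|) ≤ N * u ^ 2 * 1 := by gcongr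
    linarith
  have hx3 : ‖x‖ ^ 2 ≤ 4 * K ^ 2 * v ^ 3 / N := by
    have h1 : ‖x‖ ^ 2 ≤ (N * (2 * K * |u| ^ 3)) ^ 2 := by gcongr
    refine h1.trans (le_of_eq ?_)
    rw [hv, ← habs2]
    field_simp
    ring
  have he : ‖Complex.exp x - (1 + x)‖ ≤ ‖x‖ ^ 2 * Real.exp ‖x‖ := by
    have := Complex.norm_exp_sub_sum_le_norm_mul_exp x 2
    simpa [Finset.sum_range_succ] using this
  have hNR : ‖N * R‖ ≤ K * v ^ 2 / N := by
    rw [norm_mul, Complex.norm_real, Real.norm_of_nonneg hN0.le]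
    calc N * ‖R‖ ≤ N * (K * u ^ 4) := by gcongr
      _ = _ := by rw [hv]; field_simp
  -- Here 3072 = 3!·8³, and below 128 = 2!·8². The exponents add up to -1/2 + 1/4 + 1/8 = -1/8.
  have e3 : v ^ 3 ≤ 3072 * Real.exp (v / 8) := by
    have := Real.pow_div_factorial_le_exp (v / 8) (by positivity) 3
    norm_num [Nat.factorial] at this
    nlinarith
  have e2 : v ^ 2 ≤ 128 * Real.exp (v / 8) := by
    have := Real.pow_div_factorial_le_exp (v / 8) (by positivity) 2
    norm_num [Nat.factorial] at this
    nlinarith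
  have hexp4 : Real.exp ‖x‖ ≤ Real.exp (v / 4) := Real.exp_le_exp.2 hx2
  have h1v : 1 ≤ Real.exp (v / 4) := Real.one_le_exp (by positivity)
  rw [hid, norm_mul, hne]
  calc Real.exp (-v / 2) * ‖(Complex.exp x - (1 + x)) + N * R‖
      ≤ Real.exp (-v / 2) * (4 * K ^ 2 * v ^ 3 / N * Real.exp (v / 4)
          + K * v ^ 2 / N * Real.exp (v / 4)) := by
        gcongr
        refine (norm_add_le _ _).trans (add_le_add (he.trans ?_) (hNR.trans ?_))
        · gcongr
        · exact le_mul_of_one_le_right (by positivity) h1v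
    _ = Real.exp (-v / 2) * Real.exp (v / 4) * ((4 * K ^ 2 * v ^ 3 + K * v ^ 2) / N) := by ring
    _ ≤ Real.exp (-v / 2) * Real.exp (v / 4) * ((4 * K ^ 2 * (3072 * Real.exp (v / 8))
          + K * (128 * Real.exp (v / 8))) / N) := by gcongr
    _ = (12288 * K ^ 2 + 128 * K) / N *
          (Real.exp (-v / 2) * Real.exp (v / 4) * Real.exp (v / 8)) := by ring
    _ = _ := by
        rw [← Real.exp_add, ← Real.exp_add, hv]
        ring_nf

/-- Laplace's method with a uniform error bound: the phase is `-u²/2 + c u³ + O(u⁴)`. -/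
theorem exists_laplace_bound {K δ : ℝ} (hK : 0 < K) (hδ : 0 < δ) (hδ1 : δ ≤ 1)
    (hδK : 8 * K * δ ≤ 1) :
    ∃ A : ℝ, 0 < A ∧ ∀ (φ : ℝ → ℂ) (c : ℂ), ContinuousOn φ (Icc (-δ) δ) → ‖c‖ ≤ K →
      (∀ u ∈ Icc (-δ) δ, ‖φ u + (u : ℂ) ^ 2 / 2 - c * (u : ℂ) ^ 3‖ ≤ K * u ^ 4) →
      ∀ N : ℝ, 1 ≤ N →
        ‖(∫ u in (-δ)..δ, Complex.exp (N * φ u)) - (√(2 * Real.pi / N) : ℝ)‖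
          ≤ A / N * √(2 * Real.pi / N) := by
  set A := 12288 * K ^ 2 + 128 * K + 3 / δ ^ 2 with hA
  refine ⟨2 * A, by positivity, fun φ c hφ hc hexpand N hN => ?_⟩
  have hN0 : (0 : ℝ) < N := by linarith
  set s : Set ℝ := Ioc (-δ) δ
  -- The cubic term is removed at no cost, since its integral vanishes; kept in the error, its
  -- absolute value would be of relative size N^(-1/2).
  set F : ℝ → ℂ := fun u => Complex.exp (N * φ u)
      - N * c * (u : ℂ) ^ 3 * Complex.exp (-(N * (u : ℂ) ^ 2 / 2)) with hF
  set G : ℝ → ℂ := fun u => Complex.exp (-(N * (u : ℂ) ^ 2 / 2)) with hG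
  have hGr : G = fun u : ℝ => ((Real.exp (-(N / 2) * u ^ 2) : ℝ) : ℂ) := by
    funext u
    rw [hG]; push_cast; ring_nf
  have hGi : MeasureTheory.Integrable G := by
    rw [hGr]
    exact (integrable_exp_neg_mul_sq (by positivity)).ofReal
  have hGv : ∫ u, G u = ((√(2 * Real.pi / N) : ℝ) : ℂ) := by
    rw [hGr, integral_complex_ofReal, integral_gaussian]
    rw [show Real.pi / (N / 2) = 2 * Real.pi / N by field_simp]
  have hle : -δ ≤ δ := by linarith
  have hE : ContinuousOn (fun u => Complex.exp (N * φ u)) (Icc (-δ) δ) := by fun_prop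
  have hP : Continuous fun u : ℝ =>
      N * c * (u : ℂ) ^ 3 * Complex.exp (-(N * (u : ℂ) ^ 2 / 2)) := by fun_prop
  have hFc : ContinuousOn F (Icc (-δ) δ) := hE.sub hP.continuousOn
  have hFi : MeasureTheory.IntegrableOn F s := hFc.integrableOn_Icc.mono_set Ioc_subset_Icc_self
  have hFint : ∫ u in (-δ)..δ, Complex.exp (N * φ u) = ∫ u, s.indicator F u := by
    rw [MeasureTheory.integral_indicator measurableSet_Ioc,
      ← intervalIntegral.integral_of_le hle, hF, intervalIntegral.integral_sub,
      integral_cube_mul_exp_neg_sq, sub_zero]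
    · exact ContinuousOn.intervalIntegrable (by rwa [uIcc_of_le hle])
    · exact hP.intervalIntegrable _ _
  -- One majorant serves both regions: the local comparison inside [-δ, δ], and outside it the
  -- Gaussian tail, where `F` is extended by zero. Its integral is 2A/N · √(2π/N).
  have hbound : ∀ u, ‖s.indicator F u - G u‖ ≤ A / N * Real.exp (-(N / 8) * u ^ 2) := by
    intro u
    by_cases hu : u ∈ s
    · rw [indicator_of_mem hu]
      have hua : |u| ≤ δ := abs_le.2 ⟨hu.1.le, hu.2⟩
      refine (norm_exp_sub_gaussian_le hK hN (hua.trans hδ1) ?_ hc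
        (hexpand u ⟨hu.1.le, hu.2⟩)).trans ?_
      · refine le_trans ?_ hδK
        gcongr
      · gcongr
        rw [hA]
        have : 0 < 3 / δ ^ 2 := by positivity
        linarith
    · rw [indicator_of_notMem hu, zero_sub, norm_neg, hGr]
      simp only [Complex.norm_real, Real.norm_eq_abs, Real.abs_exp]
      have hδu : δ ^ 2 ≤ u ^ 2 := by
        refine sq_le_sq.2 ?_
        rw [abs_of_pos hδ]
        by_contra! hlt
        exact hu ⟨(abs_lt.1 hlt).1, (abs_lt.1 hlt).2.le⟩
      have h1 : Real.exp (-(N / 2) * u ^ 2) =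
          Real.exp (-(3 * N / 8 * u ^ 2)) * Real.exp (-(N / 8) * u ^ 2) := by
        rw [← Real.exp_add]; ring_nf
      rw [h1]
      gcongr
      rw [Real.exp_neg]
      have h2 : N * δ ^ 2 / 3 ≤ Real.exp (3 * N / 8 * u ^ 2) := by
        have := Real.add_one_le_exp (3 * N / 8 * u ^ 2)
        nlinarith [mul_le_mul_of_nonneg_left hδu hN0.le, sq_nonneg δ,
          mul_nonneg hN0.le (sq_nonneg δ)]
      calc (Real.exp (3 * N / 8 * u ^ 2))⁻¹ ≤ (N * δ ^ 2 / 3)⁻¹ := by gcongr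
        _ = 3 / δ ^ 2 / N := by field_simp
        _ ≤ A / N := by
          gcongr
          rw [hA]
          have : 0 < 12288 * K ^ 2 + 128 * K := by positivity
          linarith
  have hgi : MeasureTheory.Integrable fun u : ℝ => A / N * Real.exp (-(N / 8) * u ^ 2) :=
    (integrable_exp_neg_mul_sq (by positivity)).const_mul _
  have hmain := MeasureTheory.norm_integral_le_of_norm_le hgi
    (Filter.Eventually.of_forall hbound)
  rw [MeasureTheory.integral_sub (hFi.integrable_indicator measurableSet_Ioc) hGi, hGv,
    ← hFint, MeasureTheory.integral_const_mul, integral_gaussian] at hmain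
  refine hmain.trans (le_of_eq ?_)
  have : Real.pi / (N / 8) = 2 ^ 2 * (2 * Real.pi / N) := by field_simp; norm_num
  rw [this, Real.sqrt_mul (by norm_num), Real.sqrt_sq (by norm_num)]
  ring

/-! ### Exponentially small contributions and deformation of the contour. -/

/-- `I i N` is smaller than `exp (N * m i)` by a factor exponential in `N`, uniformly in `i`. -/
def ExponentiallySmall {ι : Type*} (l : Filter ι) (m : ι → ℝ) (I : ι → ℝ → ℂ) : Prop :=
  ∃ c > 0, ∃ K ≥ 0, ∀ᶠ i in l, ∀ N : ℝ, 0 ≤ N → ‖I i N‖ ≤ K * Real.exp (N * (m i - c))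

namespace ExponentiallySmall

variable {ι : Type*} {l : Filter ι} {m : ι → ℝ} {I J : ι → ℝ → ℂ}

theorem add (hI : ExponentiallySmall l m I) (hJ : ExponentiallySmall l m J) :
    ExponentiallySmall l m fun i N => I i N + J i N := by
  obtain ⟨c, hc, K, hK, h⟩ := hI
  obtain ⟨c', hc', K', hK', h'⟩ := hJ
  refine ⟨min c c', lt_min hc hc', K + K', add_nonneg hK hK', ?_⟩
  filter_upwards [h, h'] with i h h' N hN
  calc ‖I i N + J i N‖ ≤ ‖I i N‖ + ‖J i N‖ := norm_add_le _ _
    _ ≤ K * Real.exp (N * (m i - c)) + K' * Real.exp (N * (m i - c')) :=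
        add_le_add (h N hN) (h' N hN)
    _ ≤ K * Real.exp (N * (m i - min c c')) + K' * Real.exp (N * (m i - min c c')) := by
        gcongr
        · exact min_le_left _ _
        · exact min_le_right _ _
    _ = _ := by ring

theorem neg (hI : ExponentiallySmall l m I) : ExponentiallySmall l m fun i N => -I i N := by
  simpa [ExponentiallySmall] using hI

theorem congr (hI : ExponentiallySmall l m I) (h : ∀ᶠ i in l, ∀ N, I i N = J i N) :
    ExponentiallySmall l m J := by
  obtain ⟨c, hc, K, hK, h'⟩ := hI
  refine ⟨c, hc, K, hK, ?_⟩
  filter_upwards [h, h'] with i h h' N hN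
  rw [← h N]
  exact h' N hN

theorem zero : ExponentiallySmall l m fun _ _ => 0 :=
  ⟨1, one_pos, 0, le_rfl, by simp⟩

end ExponentiallySmall

/-- If `Re f₀ < M` on a segment, then the integrals of `exp (N f i)` along nearby segments are
exponentially small. -/
theorem exponentiallySmall_segmentIntegral {ι : Type*} {l : Filter ι} {m : ι → ℝ} {M : ℝ}
    {f : ι → ℂ → ℂ} {f₀ : ℂ → ℂ} {U : Set ℂ} (hU : IsOpen U)
    (hlim : TendstoLocallyUniformlyOn f f₀ l U) (hf₀ : ContinuousOn f₀ U)
    (hm : Tendsto m l (𝓝 M)) {q p : ι → ℂ} {q₀ p₀ : ℂ} (hq : Tendsto q l (𝓝 q₀))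
    (hp : Tendsto p l (𝓝 p₀)) (hseg : ∀ w ∈ segment ℝ q₀ p₀, w ∈ U ∧ (f₀ w).re < M) :
    ExponentiallySmall l m fun i N =>
      segmentIntegral (fun w => Complex.exp (N * f i w)) (q i) (p i) := by
  set S := segment ℝ q₀ p₀
  have hS : IsCompact S := by
    simp only [S, ← convexHull_pair]
    exact (toFinite _).isCompact_convexHull ℝ
  set V := U ∩ f₀ ⁻¹' {w | w.re < M}
  have hV : IsOpen V := hf₀.isOpen_inter_preimage hU (isOpen_lt Complex.continuous_re continuous_const)
  obtain ⟨η, hη, hT⟩ := hS.exists_cthickening_subset_open hV fun w hw => hseg w hw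
  have hTc : IsCompact (Metric.cthickening η S) := hS.cthickening
  have hTU : Metric.cthickening η S ⊆ U := hT.trans inter_subset_left
  obtain ⟨w₀, hw₀, hmax⟩ := hTc.exists_isMaxOn
    ⟨q₀, Metric.self_subset_cthickening S (left_mem_segment ℝ q₀ p₀)⟩
    (Complex.continuous_re.comp_continuousOn (hf₀.mono hTU))
  have hlt : (f₀ w₀).re < M := (hT hw₀).2
  -- The gap below M is 4c on the thickened segment. Replacing `f₀` by `f i` costs c, and replacing
  -- M by `m i` costs c; more than the required c is left.
  set c := (M - (f₀ w₀).re) / 4 with hc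
  have hc0 : 0 < c := by rw [hc]; linarith
  have hunif := (tendstoLocallyUniformlyOn_iff_forall_isCompact hU).1 hlim _ hTU hTc
  rw [Metric.tendstoUniformlyOn_iff] at hunif
  refine ⟨c, hc0, ‖p₀ - q₀‖ + 1, by positivity, ?_⟩
  have hd : Tendsto (fun i => ‖p i - q i‖) l (𝓝 ‖p₀ - q₀‖) := (hp.sub hq).norm
  filter_upwards [hunif c hc0, hm.eventually (Metric.ball_mem_nhds M hc0),
    hq.eventually (Metric.ball_mem_nhds q₀ hη), hp.eventually (Metric.ball_mem_nhds p₀ hη),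
    hd.eventually (gt_mem_nhds (lt_add_one _))] with i h1 h2 h3 h4 h5 N hN
  have hsub : segment ℝ (q i) (p i) ⊆ Metric.thickening η S :=
    ((convex_segment q₀ p₀).thickening η).segment_subset
      (Metric.mem_thickening_iff.2 ⟨q₀, left_mem_segment ℝ q₀ p₀, h3⟩)
      (Metric.mem_thickening_iff.2 ⟨p₀, right_mem_segment ℝ q₀ p₀, h4⟩)
  have hg : ∀ w ∈ segment ℝ (q i) (p i),
      ‖Complex.exp (N * f i w)‖ ≤ Real.exp (N * (m i - c)) := by
    intro w hw
    have hwT := Metric.thickening_subset_cthickening η S (hsub hw)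
    rw [Complex.norm_exp, Complex.re_ofReal_mul]
    gcongr
    have e1 : (f₀ w).re ≤ (f₀ w₀).re := hmax hwT
    have e2 := h1 w hwT
    rw [dist_comm, dist_eq_norm] at e2
    have e3 := (Complex.abs_re_le_norm (f i w - f₀ w)).trans e2.le
    rw [Complex.sub_re] at e3
    have e4 : |m i - M| < c := h2
    have e5 := (abs_lt.1 e4).1
    have e6 := (abs_le.1 e3).2
    have e7 : (f₀ w₀).re = M - 4 * c := by rw [hc]; ring
    linarith
  calc _ ≤ Real.exp (N * (m i - c)) * ‖p i - q i‖ := norm_segmentIntegral_le hg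
    _ ≤ Real.exp (N * (m i - c)) * (‖p₀ - q₀‖ + 1) := by gcongr
    _ = _ := mul_comm _ _

/-- The integral of `exp (N f)` along the curve `γ` between the times `a` and `b`, corrected by the
integrals along the segments that join `Q a` to `γ a` and `Q b` to `γ b`: the integral along a
deformed curve that joins `Q a` to `Q b`. -/
noncomputable def deformedIntegral (f : ℂ → ℂ) (γ Q : ℝ → ℂ) (a b : ℝ) (N : ℝ) : ℂ :=
  (∫ t in a..b, Complex.exp (N * f (γ t)) * deriv γ t)
    - segmentIntegral (fun w => Complex.exp (N * f w)) (Q b) (γ b)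
    + segmentIntegral (fun w => Complex.exp (N * f w)) (Q a) (γ a)

theorem exists_primitive_exp {f : ℂ → ℂ} {w : ℂ} {ρ : ℝ}
    (hf : DifferentiableOn ℂ f (Metric.ball w ρ)) (N : ℝ) :
    ContinuousOn (fun v => Complex.exp (N * f v)) (Metric.ball w ρ) ∧
      ∃ G : ℂ → ℂ, ∀ v ∈ Metric.ball w ρ, HasDerivAt G (Complex.exp (N * f v)) v := by
  have h : DifferentiableOn ℂ (fun v => Complex.exp (N * f v)) (Metric.ball w ρ) :=
    (hf.const_mul _).cexp
  exact ⟨h.continuousOn, h.isExactOn_ball⟩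

/-- Inside a disk there is a primitive, and the values at `γ a` and `γ b` cancel. -/
theorem deformedIntegral_eq_segmentIntegral {f : ℂ → ℂ} {γ Q : ℝ → ℂ} {w : ℂ} {ρ a b : ℝ}
    (hf : DifferentiableOn ℂ f (Metric.ball w ρ)) (hγ : SaddlePoint.IsContour γ)
    (ha : 0 ≤ a) (hab : a ≤ b) (hb : b ≤ 1) (hγB : ∀ t ∈ Icc a b, γ t ∈ Metric.ball w ρ)
    (hQa : Q a ∈ Metric.ball w ρ) (hQb : Q b ∈ Metric.ball w ρ) (N : ℝ) :
    deformedIntegral f γ Q a b N =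
      segmentIntegral (fun v => Complex.exp (N * f v)) (Q a) (Q b) := by
  obtain ⟨hc, G, hG⟩ := exists_primitive_exp hf N
  have hconv := convex_ball w ρ
  rw [deformedIntegral, hγ.integral_eq_sub ha hab hb hγB hG hc,
    segmentIntegral_eq_sub hconv hG hc hQb (hγB b ⟨hab, le_rfl⟩),
    segmentIntegral_eq_sub hconv hG hc hQa (hγB a ⟨le_rfl, hab⟩),
    segmentIntegral_eq_sub hconv hG hc hQa hQb]
  ring

/-- The correction at the common time b occurs with both signs, so local statements can be chained
along the curve. -/
theorem deformedIntegral_add {f : ℂ → ℂ} {γ Q : ℝ → ℂ} {U : Set ℂ} {a b c : ℝ}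
    (hf : ContinuousOn f U) (hγ : SaddlePoint.IsContour γ) (ha : 0 ≤ a) (hab : a ≤ b)
    (hbc : b ≤ c) (hc : c ≤ 1) (hγU : ∀ t ∈ Icc a c, γ t ∈ U) (N : ℝ) :
    deformedIntegral f γ Q a b N + deformedIntegral f γ Q b c N = deformedIntegral f γ Q a c N := by
  have hcont : ContinuousOn (fun t => Complex.exp (N * f (γ t))) (Icc a c) := by
    have := hf.comp (hγ.continuousOn.mono (Icc_subset_Icc ha hc)) hγU
    exact (continuousOn_const.mul this).cexp
  rw [deformedIntegral, deformedIntegral, deformedIntegral,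
    ← intervalIntegral.integral_add_adjacent_intervals (b := b)
      (hγ.intervalIntegrable_mul_deriv (g := fun w => Complex.exp (N * f w)) ha hab (hbc.trans hc)
        (hcont.mono (Icc_subset_Icc_right hbc)))
      (hγ.intervalIntegrable_mul_deriv (g := fun w => Complex.exp (N * f w)) (ha.trans hab) hbc hc
        (hcont.mono (Icc_subset_Icc_left hab)))]
  ring

/-- If the curve `γ₀` can be deformed to a curve `Q` in `{Re f₀ < M}`, then the contribution of
`γ i` to the integral of `exp (N f i)` is exponentially small, up to the segments at the ends. -/
theorem exponentiallySmall_deformedIntegral {ι : Type*} {l : Filter ι} {m : ι → ℝ} {M : ℝ}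
    {f : ι → ℂ → ℂ} {f₀ : ℂ → ℂ} {U : Set ℂ} (hU : IsOpen U)
    (hf : ∀ᶠ i in l, DifferentiableOn ℂ (f i) U)
    (hlim : TendstoLocallyUniformlyOn f f₀ l U) (hf₀ : ContinuousOn f₀ U)
    (hm : Tendsto m l (𝓝 M)) {γ : ι → ℝ → ℂ} {γ₀ Q : ℝ → ℂ}
    (hγ : ∀ᶠ i in l, SaddlePoint.IsContour (γ i))
    (hγlim : TendstoUniformlyOn γ γ₀ l (Icc 0 1)) (hγ₀ : ContinuousOn γ₀ (Icc 0 1))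
    {a b ρ : ℝ} (ha : 0 ≤ a) (hab : a ≤ b) (hb : b ≤ 1) (hρ : 0 < ρ)
    (hball : ∀ t ∈ Icc a b, Metric.ball (γ₀ t) ρ ⊆ U) (hQ : ContinuousOn Q (Icc a b))
    (hQγ : ∀ t ∈ Icc a b, dist (Q t) (γ₀ t) < ρ) (hQM : ∀ t ∈ Icc a b, (f₀ (Q t)).re < M) :
    ExponentiallySmall l m fun i N => deformedIntegral (f i) (γ i) Q a b N := by
  have hsub : Icc a b ⊆ Icc 0 1 := Icc_subset_Icc ha hb
  rw [Metric.tendstoUniformlyOn_iff] at hγlim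
  have hclose : ∀ᶠ i in l, ∀ t ∈ Icc a b, dist (γ i t) (γ₀ t) < ρ / 2 := by
    filter_upwards [hγlim (ρ / 2) (by positivity)] with i hi t ht
    rw [dist_comm]
    exact hi t (hsub ht)
  have hγU : ∀ᶠ i in l, ∀ t ∈ Icc a b, γ i t ∈ U := by
    filter_upwards [hclose] with i hi t ht
    exact hball t ht (Metric.mem_ball.2 ((hi t ht).trans (by linarith)))
  set V := U ∩ f₀ ⁻¹' {w | w.re < M}
  have hV : IsOpen V := hf₀.isOpen_inter_preimage hU (isOpen_lt Complex.continuous_re continuous_const)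
  have hlocal : ∀ t : Icc a b, ∃ O : Set (Icc a b), IsOpen O ∧ t ∈ O ∧ ∀ a' b' : Icc a b,
      a' ≤ b' → Icc a' b' ⊆ O →
      ExponentiallySmall l m fun i N => deformedIntegral (f i) (γ i) Q a' b' N := by
    intro t
    obtain ⟨r, hr, hrV⟩ := Metric.isOpen_iff.1 hV (Q t)
      ⟨hball t t.2 (Metric.mem_ball.2 (hQγ t t.2)), hQM t t.2⟩
    have hQc : Continuous fun t : Icc a b => Q t := continuousOn_iff_continuous_domRestrict.1 hQ
    have hγc : Continuous fun t : Icc a b => γ₀ t :=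
      continuousOn_iff_continuous_domRestrict.1 (hγ₀.mono hsub)
    -- The first condition leaves ρ/2 for the distance from `γ₀` to `γ i`, so both curves stay in
    -- the disk of radius ρ about `γ₀ t`. The last one keeps the chord of `Q` in {Re f₀ < M}.
    refine ⟨{x | dist (γ₀ x) (γ₀ t) < ρ / 2} ∩ {x | dist (Q x) (γ₀ t) < ρ}
      ∩ {x | dist (Q x) (Q t) < r}, ?_, ?_, ?_⟩
    · exact ((isOpen_lt (hγc.dist continuous_const) continuous_const).inter
        (isOpen_lt (hQc.dist continuous_const) continuous_const)).inter
        (isOpen_lt (hQc.dist continuous_const) continuous_const)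
    · exact ⟨⟨by simpa using hρ, hQγ t t.2⟩, by simpa using hr⟩
    · intro a' b' hab' hO
      have ha' := hO ⟨le_rfl, hab'⟩
      have hb' := hO ⟨hab', le_rfl⟩
      refine (exponentiallySmall_segmentIntegral hU hlim hf₀ hm (q := fun _ => Q a')
        (p := fun _ => Q b') tendsto_const_nhds tendsto_const_nhds fun w hw => hrV
          ((convex_ball (Q t) r).segment_subset ha'.2 hb'.2 hw)).congr ?_
      filter_upwards [hf, hγ, hclose] with i hfi hγi hi N
      refine (deformedIntegral_eq_segmentIntegral (hfi.mono (hball t t.2)) hγi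
        (ha.trans a'.2.1) hab' (b'.2.2.trans hb) (fun x hx => ?_) ha'.1.2 hb'.1.2 N).symm
      have hxm : x ∈ Icc a b := ⟨a'.2.1.trans hx.1, hx.2.trans b'.2.2⟩
      have hx' : dist (γ₀ x) (γ₀ t) < ρ / 2 := (hO (show (⟨x, hxm⟩ : Icc a b) ∈ Icc a' b' from hx)).1.1
      rw [Metric.mem_ball]
      linarith [dist_triangle (γ i x) (γ₀ x) (γ₀ t), hi x hxm]
  choose O hO htO hE using hlocal
  -- Compactness gives a finite subdivision into such short intervals; the contributions are then
  -- added.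
  obtain ⟨p, hp0, hpm, ⟨n, hn⟩, hpO⟩ := exists_monotone_Icc_subset_open_cover_Icc hab hO
    (fun t _ => mem_iUnion.2 ⟨t, htO t⟩)
  have key : ∀ k, ExponentiallySmall l m fun i N => deformedIntegral (f i) (γ i) Q a (p k) N := by
    intro k
    induction k with
    | zero =>
      refine ExponentiallySmall.zero.congr (Filter.Eventually.of_forall fun i N => ?_)
      simp [hp0, deformedIntegral]
    | succ k ih =>
      obtain ⟨t, ht⟩ := hpO k
      refine (ih.add (hE t _ _ (hpm k.le_succ) ht)).congr ?_
      filter_upwards [hf, hγ, hγU] with i hfi hγi hi N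
      exact deformedIntegral_add hfi.continuousOn hγi ha (p k).2.1 (hpm k.le_succ)
        ((p (k + 1)).2.2.trans hb) (fun t ht => hi t ⟨ht.1, ht.2.trans (p (k + 1)).2.2⟩) N
  have := key n
  rwa [hn n le_rfl] at this

/-! ### Gradient descent steps. -/

theorem exists_uniform_taylor_of_isCompact {f : ℂ → ℂ} {U Γ : Set ℂ} (hU : IsOpen U)
    (hf : DifferentiableOn ℂ f U) (hΓ : IsCompact Γ) (hΓU : Γ ⊆ U) :
    ∃ ρ > 0, ∃ K > 0, ∀ w ∈ Γ, Metric.ball w ρ ⊆ U ∧ ‖deriv f w‖ ≤ K ∧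
      ∀ v ∈ Metric.ball w ρ, ‖f v - f w - deriv f w * (v - w)‖ ≤ K * ‖v - w‖ ^ 2 := by
  obtain ⟨ρ, hρ, hT⟩ := hΓ.exists_cthickening_subset_open hU hΓU
  obtain ⟨B, hB⟩ := hΓ.cthickening.exists_bound_of_continuousOn (hf.continuousOn.mono hT)
  obtain ⟨K, hK, h⟩ := exists_uniform_taylor B hρ
  have hsub : ∀ w ∈ Γ, Metric.ball w ρ ⊆ Metric.cthickening ρ Γ := fun w hw =>
    Metric.ball_subset_closedBall.trans (Metric.closedBall_subset_cthickening hw ρ)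
  refine ⟨ρ, hρ, K, hK, fun w hw => ⟨(hsub w hw).trans hT, ?_⟩⟩
  obtain ⟨h1, h2, -⟩ := h f w (hf.mono ((hsub w hw).trans hT)) fun v hv => hB v (hsub w hw hv)
  exact ⟨h1, h2⟩

/-- One step of size `s` in the direction of steepest descent of `Re f`. -/
noncomputable def descentStep (f : ℂ → ℂ) (s : ℝ) (w : ℂ) : ℂ :=
  w - s * (starRingEnd ℂ) (deriv f w)

theorem dist_descentStep (f : ℂ → ℂ) {s : ℝ} (hs : 0 ≤ s) (w : ℂ) :
    dist (descentStep f s w) w = s * ‖deriv f w‖ := by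
  rw [descentStep, dist_eq_norm, sub_sub_cancel_left, norm_neg, norm_mul, Complex.norm_real,
    Real.norm_of_nonneg hs, RCLike.norm_conj]

/-- The linear term is exactly -s‖f'(w)‖², and the quadratic remainder K s²‖f'(w)‖² uses up at most
half of it. -/
theorem re_descentStep_le {f : ℂ → ℂ} {s K : ℝ} {w : ℂ} (hs : 0 ≤ s) (hsK : s * K ≤ 1 / 2)
    (h : ‖f (descentStep f s w) - f w - deriv f w * (descentStep f s w - w)‖
      ≤ K * ‖descentStep f s w - w‖ ^ 2) :
    (f (descentStep f s w)).re ≤ (f w).re - s / 2 * ‖deriv f w‖ ^ 2 := by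
  have h1 : ‖descentStep f s w - w‖ = s * ‖deriv f w‖ := by
    rw [← dist_eq_norm, dist_descentStep f hs]
  have h2 : deriv f w * (descentStep f s w - w) = ((-(s * ‖deriv f w‖ ^ 2) : ℝ) : ℂ) := by
    rw [descentStep, sub_sub_cancel_left]
    push_cast
    rw [← Complex.mul_conj']
    ring
  rw [h1, h2] at h
  have h3 := (Complex.abs_re_le_norm _).trans h
  rw [Complex.sub_re, Complex.sub_re, Complex.ofReal_re] at h3
  have h4 := (abs_le.1 h3).2
  have h5 : K * (s * ‖deriv f w‖) ^ 2 ≤ s / 2 * ‖deriv f w‖ ^ 2 := by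
    have : K * (s * ‖deriv f w‖) ^ 2 = s * K * (s * ‖deriv f w‖ ^ 2) := by ring
    rw [this]
    have : s * K * (s * ‖deriv f w‖ ^ 2) ≤ 1 / 2 * (s * ‖deriv f w‖ ^ 2) := by gcongr
    linarith
  linarith

/-! ### The sector of descent at the saddle point. -/

theorem sq_re_add_sq_im (u : ℂ) : u.re ^ 2 + u.im ^ 2 = ‖u‖ ^ 2 := by
  rw [← Complex.normSq_eq_norm_sq, Complex.normSq_apply]; ring

theorem re_sq (u : ℂ) : (u ^ 2).re = u.re ^ 2 - u.im ^ 2 := by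
  rw [sq, Complex.mul_re]; ring

/-- A converse, with a worse constant, to `re_pos_and_abs_im_le`. The linear inequality survives
convex combinations, so it carries the quadratic bound from the ends of a segment to all its points.
-/
theorem re_sq_ge_of_abs_im_le {u : ℂ} {κ : ℝ} (hκ : 0 < κ) (hκ1 : κ ≤ 1)
    (h : |u.im| ≤ (1 - κ / 2) * u.re) : κ / 4 * ‖u‖ ^ 2 ≤ (u ^ 2).re := by
  rw [re_sq, ← sq_re_add_sq_im]
  have h1 : u.im ^ 2 ≤ ((1 - κ / 2) * u.re) ^ 2 := by
    rw [← sq_abs u.im]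
    gcongr
  have h2 : 0 ≤ κ * (1 - κ) * u.re ^ 2 :=
    mul_nonneg (mul_nonneg hκ.le (by linarith)) (sq_nonneg _)
  have h3 : (1 + κ / 4) * u.im ^ 2 ≤ (1 + κ / 4) * ((1 - κ / 2) * u.re) ^ 2 := by gcongr
  have h4 : 0 ≤ κ ^ 2 * (1 - κ) * u.re ^ 2 :=
    mul_nonneg (mul_nonneg (sq_nonneg _) (by linarith)) (sq_nonneg _)
  have h5 : 0 ≤ κ * u.re ^ 2 := by positivity
  have h6 : 0 ≤ κ ^ 2 * u.re ^ 2 := by positivity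
  nlinarith

/-- A point where `-Re (bξ)²` is small and which lies almost to the right is in the right half
of the sector. -/
theorem re_pos_and_abs_im_le {b ξ : ℂ} {κ η : ℝ} (hb : |b.im| < b.re) (hκ : 0 < κ) (hκ1 : κ ≤ 1)
    (hη : 2 * η * ‖b‖ ≤ b.re - |b.im|) (hre : -(η * ‖ξ‖) < ξ.re)
    (h : κ * ‖b * ξ‖ ^ 2 ≤ ((b * ξ) ^ 2).re) :
    0 < (b * ξ).re ∧ |(b * ξ).im| ≤ (1 - κ / 2) * (b * ξ).re := by
  have hb0 : 0 < ‖b‖ := norm_pos_iff.2 (by rintro rfl; simp at hb)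
  have hξ : 0 < ‖ξ‖ := norm_pos_iff.2 (by rintro rfl; simp at hre)
  set u := b * ξ with hu
  have hun : ‖u‖ = ‖b‖ * ‖ξ‖ := norm_mul _ _
  have hu0 : 0 < ‖u‖ := by rw [hun]; positivity
  rw [re_sq] at h
  have hsum := sq_re_add_sq_im u
  have hid : ‖b‖ ^ 2 * ξ.re = u.re * b.re + u.im * b.im := by
    rw [← sq_re_add_sq_im, hu, Complex.mul_re, Complex.mul_im]; ring
  have hpos : 0 < κ * ‖u‖ ^ 2 := by positivity
  have him : |u.im| ≤ |u.re| := sq_le_sq.1 (by linarith)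
  have hre0 : 0 < u.re := by
    -- In the left half of the sector -Re u ≥ ‖u‖/2. Then ‖b‖² Re ξ = Re(u·conj b) ≤ Re u·(Re b -
    -- |Im b|) ≤ -η‖b‖²‖ξ‖, against `hre`.
    by_contra! hneg
    have h1 : ‖u‖ / 2 ≤ -u.re := by
      have : (‖u‖ / 2) ^ 2 ≤ (-u.re) ^ 2 := by nlinarith
      exact (sq_le_sq₀ (by positivity) (by linarith)).1 this
    rw [abs_of_nonpos hneg] at him
    have h2 : u.im * b.im ≤ -u.re * |b.im| := by
      calc u.im * b.im ≤ |u.im * b.im| := le_abs_self _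
        _ = |u.im| * |b.im| := abs_mul _ _
        _ ≤ _ := by gcongr
    have h3 : ‖b‖ ^ 2 * ξ.re ≤ u.re * (b.re - |b.im|) := by rw [hid]; linarith
    have h4 : u.re * (b.re - |b.im|) ≤ -(‖u‖ / 2) * (b.re - |b.im|) :=
      mul_le_mul_of_nonneg_right (by linarith) (by linarith)
    have h5 : -(‖u‖ / 2) * (b.re - |b.im|) ≤ -(‖u‖ / 2) * (2 * η * ‖b‖) :=
      mul_le_mul_of_nonpos_left hη (by linarith)
    have h6 : ‖b‖ ^ 2 * (-(η * ‖ξ‖)) < ‖b‖ ^ 2 * ξ.re := by gcongr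
    rw [hun] at h4 h5
    linarith
  refine ⟨hre0, abs_le_of_sq_le_sq ?_ (by nlinarith)⟩
  have h1 : (1 + κ) * u.im ^ 2 ≤ (1 - κ) * u.re ^ 2 := by nlinarith
  have h2 : (1 - κ) * u.re ^ 2 ≤ (1 + κ) * ((1 - κ / 2) * u.re) ^ 2 := by
    have : 0 ≤ κ ^ 2 * (3 + κ) * u.re ^ 2 := by positivity
    have h4 : 0 ≤ κ * (1 - κ) * u.re ^ 2 :=
      mul_nonneg (mul_nonneg hκ.le (by linarith)) (sq_nonneg _)
    have h5 : 0 ≤ κ ^ 2 * u.re ^ 2 := by positivity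
    have h6 : 0 ≤ κ ^ 3 * u.re ^ 2 := by positivity
    nlinarith
  have h3 : 0 < 1 + κ := by linarith
  exact le_of_mul_le_mul_left (h1.trans h2) h3

/-- In a sector around the steepest descent direction at a nondegenerate saddle point `z`, a
segment from a point reached by a descent step to a point on the descent direction stays strictly
below the saddle point. The sign `σ` selects the half of the sector. -/
theorem exists_segment_below_saddle {f : ℂ → ℂ} {z b : ℂ} {K ρ : ℝ} (hK : 0 < K) (hρ : 0 < ρ)
    (hb : |b.im| < b.re)
    (hf : ∀ w ∈ Metric.ball z ρ, ‖f w - f z + b ^ 2 / 2 * (w - z) ^ 2‖ ≤ K * ‖w - z‖ ^ 3) :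
    ∃ s₁ > (0 : ℝ), ∀ s ∈ Ioc 0 s₁, ∃ r > (0 : ℝ), ∀ δ ∈ Ioc 0 r, ∀ σ : ℝ, σ = 1 ∨ σ = -1 → ∀ P Q d : ℂ,
      ‖P - z‖ ≤ r → 0 < σ * (P - z).re → ‖b‖ ^ 2 * ‖P - z‖ ≤ 2 * ‖d‖ →
      ‖d‖ ≤ 2 * ‖b‖ ^ 2 * ‖P - z‖ → Q - P = -(s * (starRingEnd ℂ) d) →
      (f Q).re ≤ (f z).re - s / 2 * ‖d‖ ^ 2 →
      ∀ w ∈ segment ℝ (z + σ * δ / b) Q, w ∈ Metric.ball z ρ ∧ (f w).re < (f z).re := by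
  have hb0 : 0 < ‖b‖ := norm_pos_iff.2 (by rintro rfl; simp at hb)
  have hbne : b ≠ 0 := norm_pos_iff.1 hb0
  set A := ‖b‖ ^ 2 with hA
  have hA0 : 0 < A := by positivity
  have hgap : 0 < b.re - |b.im| := by linarith
  -- The first bound makes the step at most ‖P - z‖/2; the second lets it tilt Re(P - z) by less
  -- than the margin that |arg b| < π/4 provides.
  refine ⟨min (1 / (4 * A)) ((b.re - |b.im|) / (8 * A * ‖b‖)), by positivity, fun s hs => ?_⟩
  have hs0 : 0 < s := hs.1
  have hsA : s * A ≤ 1 / 4 := by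
    have := (hs.2.trans (min_le_left _ _))
    rw [le_div_iff₀ (by positivity)] at this
    linarith
  have hsη : 2 * (4 * s * A) * ‖b‖ ≤ b.re - |b.im| := by
    have := (hs.2.trans (min_le_right _ _))
    rw [le_div_iff₀ (by positivity)] at this
    linarith
  -- Since ‖d‖ ≥ A‖Q - z‖/4, the drop s‖d‖²/2 is at least κA‖Q - z‖². As Re f falls by Re(b(Q -
  -- z))²/2, this is twice what is needed, and the surplus absorbs the cubic error.
  set κ := s * A / 32 with hκ
  have hκ0 : 0 < κ := by positivity
  have hκ1 : κ ≤ 1 := by rw [hκ]; linarith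
  set r₀ := min (s * A ^ 2 / (1024 * K)) (ρ / 4) with hr₀
  have hr₀0 : 0 < r₀ := by positivity
  have hr₀K : K * r₀ ≤ s * A ^ 2 / 1024 := by
    have := min_le_left (s * A ^ 2 / (1024 * K)) (ρ / 4)
    rw [← hr₀, le_div_iff₀ (by positivity)] at this
    linarith
  have hr₀ρ : r₀ ≤ ρ / 4 := min_le_right _ _
  refine ⟨min r₀ (r₀ * ‖b‖), by positivity, ?_⟩
  intro δ hδ σ hσ P Q d hP hPre hd1 hd2 hQP hQ
  have hσ2 : σ ^ 2 = 1 := by rcases hσ with rfl | rfl <;> norm_num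
  have hσ2' : (σ : ℂ) ^ 2 = 1 := by exact_mod_cast hσ2
  have hσabs : |σ| = 1 := by rcases hσ with rfl | rfl <;> norm_num
  have hP' : ‖P - z‖ ≤ r₀ := hP.trans (min_le_left _ _)
  have hQPn : ‖Q - P‖ = s * ‖d‖ := by
    rw [hQP, norm_neg, norm_mul, Complex.norm_real, Real.norm_of_nonneg hs0.le, RCLike.norm_conj]
  have hsd : s * ‖d‖ ≤ 2 * (s * A) * ‖P - z‖ := by
    calc s * ‖d‖ ≤ s * (2 * A * ‖P - z‖) := by gcongr
      _ = _ := by ring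
  have hsd2 : s * ‖d‖ ≤ ‖P - z‖ / 2 := by
    have : s * A * ‖P - z‖ ≤ 1 / 4 * ‖P - z‖ := by gcongr
    linarith
  have hQz : Q - z = (Q - P) + (P - z) := by ring
  have hQle : ‖Q - z‖ ≤ 2 * ‖P - z‖ := by
    rw [hQz]; linarith [norm_add_le (Q - P) (P - z), norm_nonneg (P - z)]
  have hPle : ‖P - z‖ ≤ 2 * ‖Q - z‖ := by
    have h1 : P - z = (Q - z) - (Q - P) := by ring
    have := norm_sub_le (Q - z) (Q - P)
    rw [← h1] at this
    linarith
  have hQr : ‖Q - z‖ ≤ 2 * r₀ := by linarith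
  have hexp : ∀ w, ‖w - z‖ ≤ 2 * r₀ →
      |(f w).re - (f z).re + ((b * (σ * (w - z))) ^ 2).re / 2| ≤ K * ‖w - z‖ ^ 3 := by
    intro w hw
    have hwb : w ∈ Metric.ball z ρ := by rw [Metric.mem_ball, dist_eq_norm]; linarith
    have := (Complex.abs_re_le_norm _).trans (hf w hwb)
    have e : b ^ 2 / 2 * (w - z) ^ 2 = ((1 / 2 : ℝ) : ℂ) * (b * (σ * (w - z))) ^ 2 := by
      rw [mul_pow, mul_pow, hσ2']; push_cast; ring
    rw [e, Complex.add_re, Complex.sub_re, Complex.re_ofReal_mul] at this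
    rwa [div_eq_inv_mul, ← one_div]
  have hnorm : ∀ w, ‖b * (σ * (w - z))‖ ^ 2 = A * ‖w - z‖ ^ 2 := by
    intro w
    rw [norm_mul, norm_mul, Complex.norm_real, Real.norm_eq_abs, hσabs, hA]; ring
  have hQcone : 0 < (b * (σ * (Q - z))).re ∧
      |(b * (σ * (Q - z))).im| ≤ (1 - κ / 2) * (b * (σ * (Q - z))).re := by
    -- The step has length at most 2sA‖P - z‖ ≤ 4sA‖Q - z‖, whence η.
    refine re_pos_and_abs_im_le (η := 4 * s * A) hb hκ0 hκ1 hsη ?_ ?_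
    · rw [norm_mul, Complex.norm_real, Real.norm_eq_abs, hσabs, one_mul, Complex.re_ofReal_mul,
        hQz, Complex.add_re, mul_add, ← hQz]
      have h1 : |σ * (Q - P).re| ≤ s * ‖d‖ := by
        rw [abs_mul, hσabs, one_mul, ← hQPn]; exact Complex.abs_re_le_norm _
      have h2 := (abs_le.1 h1).1
      have h3 : s * A * ‖P - z‖ ≤ s * A * (2 * ‖Q - z‖) := by gcongr
      linarith
    · rw [hnorm]
      have h1 := (abs_le.1 (hexp Q hQr)).1
      have h2 : K * ‖Q - z‖ ^ 3 ≤ s * A ^ 2 / 512 * ‖Q - z‖ ^ 2 := by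
        calc K * ‖Q - z‖ ^ 3 = K * ‖Q - z‖ * ‖Q - z‖ ^ 2 := by ring
          _ ≤ K * (2 * r₀) * ‖Q - z‖ ^ 2 := by gcongr
          _ ≤ _ := by gcongr; linarith
      have h3 : (A * ‖Q - z‖ / 4) ^ 2 ≤ ‖d‖ ^ 2 := by
        have : A * ‖Q - z‖ / 4 ≤ ‖d‖ := by
          have : A * ‖Q - z‖ ≤ A * (2 * ‖P - z‖) := by gcongr
          linarith
        gcongr
      have h4 : s / 2 * (A * ‖Q - z‖ / 4) ^ 2 ≤ s / 2 * ‖d‖ ^ 2 := by gcongr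
      have h5 : 0 ≤ s * A ^ 2 * ‖Q - z‖ ^ 2 := by positivity
      rw [hκ]
      nlinarith
  have hcone : Convex ℝ {w : ℂ | 0 < (b * (σ * (w - z))).re ∧
      |(b * (σ * (w - z))).im| ≤ (1 - κ / 2) * (b * (σ * (w - z))).re} := by
    intro w₁ h₁ w₂ h₂ α β hα hβ hαβ
    have e : b * (σ * ((α • w₁ + β • w₂) - z)) =
        (α : ℂ) * (b * (σ * (w₁ - z))) + (β : ℂ) * (b * (σ * (w₂ - z))) := by
      have : (α : ℂ) + β = 1 := by exact_mod_cast hαβ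
      rw [Complex.real_smul, Complex.real_smul]
      linear_combination (b * σ * z) * this
    simp only [mem_ofPred_eq] at h₁ h₂ ⊢
    rw [e, Complex.add_re, Complex.add_im, Complex.re_ofReal_mul, Complex.re_ofReal_mul,
      Complex.im_ofReal_mul, Complex.im_ofReal_mul]
    constructor
    · rcases hα.eq_or_lt with h | h
      · have : β = 1 := by linarith
        rw [← h, this]; linarith [h₂.1]
      · have := mul_pos h h₁.1
        have := mul_nonneg hβ h₂.1.le
        linarith
    · refine (abs_add_le _ _).trans ?_
      rw [abs_mul, abs_mul, abs_of_nonneg hα, abs_of_nonneg hβ]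
      have := mul_le_mul_of_nonneg_left h₁.2 hα
      have := mul_le_mul_of_nonneg_left h₂.2 hβ
      linarith
  intro w hw
  have hstart : b * (σ * ((z + σ * δ / b) - z)) = (δ : ℂ) := by
    field_simp
    linear_combination (δ : ℂ) * hσ2'
  have hw1 := hcone.segment_subset (x := z + σ * δ / b) (y := Q) (by
    simp only [mem_ofPred_eq]
    rw [hstart, Complex.ofReal_re, Complex.ofReal_im, abs_zero]
    exact ⟨hδ.1, mul_nonneg (by linarith) hδ.1.le⟩) hQcone hw
  have hw2 : ‖w - z‖ ≤ 2 * r₀ := by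
    have := (convex_closedBall z (2 * r₀)).segment_subset (x := z + σ * δ / b) (y := Q) (by
      rw [Metric.mem_closedBall, dist_eq_norm, add_sub_cancel_left, norm_div, norm_mul,
        Complex.norm_real, Complex.norm_real, Real.norm_eq_abs, hσabs, one_mul,
        Real.norm_of_nonneg hδ.1.le, div_le_iff₀ hb0]
      have := hδ.2.trans (min_le_right _ _)
      have : 0 ≤ r₀ * ‖b‖ := by positivity
      linarith) (by rwa [Metric.mem_closedBall, dist_eq_norm]) hw
    rwa [Metric.mem_closedBall, dist_eq_norm] at this
  refine ⟨by rw [Metric.mem_ball, dist_eq_norm]; linarith, ?_⟩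
  have h1 := re_sq_ge_of_abs_im_le hκ0 hκ1 hw1.2
  rw [hnorm] at h1
  have h2 := (abs_le.1 (hexp w hw2)).2
  have hwpos : 0 < ‖w - z‖ := by
    refine norm_pos_iff.2 fun h => ?_
    have := hw1.1
    rw [h] at this
    simp at this
  have h3 : K * ‖w - z‖ ^ 3 ≤ s * A ^ 2 / 512 * ‖w - z‖ ^ 2 := by
    calc K * ‖w - z‖ ^ 3 = K * ‖w - z‖ * ‖w - z‖ ^ 2 := by ring
      _ ≤ K * (2 * r₀) * ‖w - z‖ ^ 2 := by gcongr
      _ ≤ _ := by gcongr; linarith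
  have h5 : 0 < s * A ^ 2 * ‖w - z‖ ^ 2 := by positivity
  rw [hκ] at h1
  nlinarith

/-! ### The central segment and comparison of error terms. -/

theorem segmentIntegral_centered (g : ℂ → ℂ) (z b : ℂ) (δ : ℝ) :
    segmentIntegral g (z - δ / b) (z + δ / b) = (∫ u in (-δ)..δ, g (z + u / b)) / b := by
  have h := intervalIntegral.smul_integral_comp_mul_add (a := 0) (b := 1)
    (fun u : ℝ => g (z + u / b)) (2 * δ) (-δ)
  rw [mul_zero, zero_add, mul_one, show 2 * δ + -δ = δ by ring] at h
  rw [← h, segmentIntegral, Complex.real_smul, intervalIntegral.integral_mul_const]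
  have e : ∀ s : ℝ, z - δ / b + s * (z + δ / b - (z - δ / b)) =
      z + ((2 * δ * s + -δ : ℝ) : ℂ) / b := by
    intro s; push_cast; ring
  simp_rw [e]
  push_cast
  ring

/-- Third-order Taylor bound at a critical point. -/
theorem exists_taylor_at_critical {f : ℂ → ℂ} {z : ℂ} {U : Set ℂ} (hU : IsOpen U) (hz : z ∈ U)
    (hf : DifferentiableOn ℂ f U) (hcrit : deriv f z = 0) :
    ∃ K > 0, ∃ ρ > 0, Metric.ball z ρ ⊆ U ∧ ∀ w ∈ Metric.ball z ρ,
      ‖f w - f z - deriv (deriv f) z / 2 * (w - z) ^ 2‖ ≤ K * ‖w - z‖ ^ 3 := by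
  obtain ⟨ρ, hρ, hρU⟩ := Metric.nhds_basis_closedBall.mem_iff.1 (hU.mem_nhds hz)
  obtain ⟨B, hB⟩ := (isCompact_closedBall z ρ).exists_bound_of_continuousOn
    (hf.continuousOn.mono hρU)
  obtain ⟨K, hK, h⟩ := exists_uniform_taylor B hρ
  have hsub := Metric.ball_subset_closedBall (x := z) (ε := ρ)
  obtain ⟨-, -, c, hc, h3⟩ := h f z (hf.mono (hsub.trans hρU)) fun w hw => hB w (hsub hw)
  refine ⟨K + K * ρ, by positivity, ρ, hρ, hsub.trans hρU, fun w hw => ?_⟩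
  have h4 := h3 w hw
  rw [hcrit, zero_mul, sub_zero] at h4
  have hwρ : ‖w - z‖ ≤ ρ := by
    rw [Metric.mem_ball, dist_eq_norm] at hw; exact hw.le
  calc _ = ‖(f w - f z - deriv (deriv f) z / 2 * (w - z) ^ 2 - c * (w - z) ^ 3)
        + c * (w - z) ^ 3‖ := by rw [sub_add_cancel]
    _ ≤ K * ‖w - z‖ ^ 4 + K * ‖w - z‖ ^ 3 := by
        refine (norm_add_le _ _).trans (add_le_add h4 ?_)
        rw [norm_mul, norm_pow]
        gcongr
    _ = (K + K * ‖w - z‖) * ‖w - z‖ ^ 3 := by ring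
    _ ≤ _ := by gcongr

/-- The contribution of a short segment through the saddle point in the direction of steepest
descent, with a relative error `O(1/N)` that is uniform in the family. -/
theorem exists_central_bound {ι : Type*} {l : Filter ι} {f : ι → ℂ → ℂ} {f₀ : ℂ → ℂ} {U : Set ℂ}
    (hU : IsOpen U) (hf : ∀ᶠ i in l, DifferentiableOn ℂ (f i) U)
    (hlim : TendstoLocallyUniformlyOn f f₀ l U) (hf₀ : ContinuousOn f₀ U) {z b : ι → ℂ}
    {z₀ b₀ : ℂ} (hz₀ : z₀ ∈ U) (hz : Tendsto z l (𝓝 z₀)) (hb₀ : b₀ ≠ 0)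
    (hb : Tendsto b l (𝓝 b₀)) (hcrit : ∀ᶠ i in l, deriv (f i) (z i) = 0)
    (hbf : ∀ᶠ i in l, b i ^ 2 = -deriv (deriv (f i)) (z i)) :
    ∃ δ₁ > (0 : ℝ), ∀ δ ∈ Ioc 0 δ₁, ∃ A > (0 : ℝ), ∀ᶠ i in l, ∀ N : ℝ, 1 ≤ N →
      ‖segmentIntegral (fun w => Complex.exp (N * f i w)) (z i - δ / b i) (z i + δ / b i)
        - Complex.exp (N * f i (z i)) * (√(2 * Real.pi / N) : ℝ) / b i‖
      ≤ A / N * √(2 * Real.pi / N) * Real.exp (N * (f i (z i)).re) := by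
  obtain ⟨R, hR, hRU⟩ := Metric.nhds_basis_closedBall.mem_iff.1 (hU.mem_nhds hz₀)
  obtain ⟨B, hB⟩ := (isCompact_closedBall z₀ R).exists_bound_of_continuousOn (hf₀.mono hRU)
  -- Half the radius because the centre is the moving point `z i`; the bound B + 1 because `f i` is
  -- within 1 of `f₀`.
  obtain ⟨K₀, hK₀, hT⟩ := exists_uniform_taylor (R := R / 2) (B + 1) (by positivity)
  have hunif := (tendstoLocallyUniformlyOn_iff_forall_isCompact hU).1 hlim _ hRU
    (isCompact_closedBall z₀ R)
  rw [Metric.tendstoUniformlyOn_iff] at hunif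
  set β := ‖b₀‖ / 2 with hβ
  have hβ0 : 0 < β := by rw [hβ]; have := norm_pos_iff.2 hb₀; positivity
  have hβlt : β < ‖b₀‖ := by rw [hβ]; have := norm_pos_iff.2 hb₀; linarith
  -- Substituting w = z + u/b divides the cubic coefficient by b³ and the quartic bound by ‖b‖⁴,
  -- with ‖b‖ > β eventually.
  set K := K₀ / β ^ 3 + K₀ / β ^ 4 with hK
  have hK0 : 0 < K := by positivity
  refine ⟨min (min 1 (1 / (8 * K))) (R / 4 * β), by positivity, fun δ hδ => ?_⟩
  have hδ1 : δ ≤ 1 := hδ.2.trans ((min_le_left _ _).trans (min_le_left _ _))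
  have hδK : 8 * K * δ ≤ 1 := by
    have := hδ.2.trans ((min_le_left _ _).trans (min_le_right _ _))
    rw [le_div_iff₀ (by positivity)] at this
    linarith
  have hδR : δ ≤ R / 4 * β := hδ.2.trans (min_le_right _ _)
  obtain ⟨A, hA, hlap⟩ := exists_laplace_bound hK0 hδ.1 hδ1 hδK
  refine ⟨A / β, by positivity, ?_⟩
  filter_upwards [hf, hunif 1 one_pos, hz.eventually (Metric.ball_mem_nhds z₀ (half_pos hR)),
    hb.norm.eventually (lt_mem_nhds hβlt), hcrit, hbf] with i hfi h1 h2 h3 h4 h5 N hN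
  have hbi : b i ≠ 0 := norm_pos_iff.1 (hβ0.trans h3)
  have hball : Metric.ball (z i) (R / 2) ⊆ Metric.closedBall z₀ R := by
    intro w hw
    rw [Metric.mem_ball] at hw
    replace h2 : dist (z i) z₀ < R / 2 := h2
    rw [Metric.mem_closedBall]
    linarith [dist_triangle w (z i) z₀]
  obtain ⟨-, -, c, hc, h6⟩ := hT (f i) (z i) (hfi.mono (hball.trans hRU)) fun w hw => by
    have e1 := hB w (hball hw)
    have e2 := h1 w (hball hw)
    rw [dist_eq_norm] at e2
    have := norm_sub_le (f₀ w) (f₀ w - f i w)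
    rw [sub_sub_cancel] at this
    linarith
  have hmem : ∀ u ∈ Icc (-δ) δ, z i + (u : ℂ) / b i ∈ Metric.ball (z i) (R / 2) := by
    intro u hu
    rw [Metric.mem_ball, dist_eq_norm, add_sub_cancel_left, norm_div, Complex.norm_real,
      Real.norm_eq_abs, div_lt_iff₀ (norm_pos_iff.2 hbi)]
    have e1 : |u| ≤ δ := abs_le.2 ⟨hu.1, hu.2⟩
    have e2 : R / 4 * β < R / 2 * ‖b i‖ := by
      have : R / 4 * β ≤ R / 4 * ‖b i‖ := by gcongr
      have : 0 < R / 4 * ‖b i‖ := by positivity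
      linarith
    linarith
  set φ : ℝ → ℂ := fun u => f i (z i + u / b i) - f i (z i) with hφ
  have hφc : ContinuousOn φ (Icc (-δ) δ) := by
    refine ContinuousOn.sub ?_ continuousOn_const
    exact (hfi.continuousOn.mono (hball.trans hRU)).comp (by fun_prop) hmem
  have hcK : ‖c / b i ^ 3‖ ≤ K := by
    rw [norm_div, norm_pow]
    have : ‖c‖ / ‖b i‖ ^ 3 ≤ K₀ / β ^ 3 := by gcongr
    have : 0 < K₀ / β ^ 4 := by positivity
    rw [hK]
    linarith
  have hexp : ∀ u ∈ Icc (-δ) δ,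
      ‖φ u + (u : ℂ) ^ 2 / 2 - c / b i ^ 3 * (u : ℂ) ^ 3‖ ≤ K * u ^ 4 := by
    intro u hu
    have e1 := h6 _ (hmem u hu)
    rw [h4, add_sub_cancel_left, zero_mul, sub_zero,
      show deriv (deriv (f i)) (z i) = -b i ^ 2 by rw [h5, neg_neg]] at e1
    have e2 : φ u + (u : ℂ) ^ 2 / 2 - c / b i ^ 3 * (u : ℂ) ^ 3 =
        f i (z i + u / b i) - f i (z i) - -b i ^ 2 / 2 * (u / b i) ^ 2 - c * (u / b i) ^ 3 := by
      rw [hφ]; field_simp; ring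
    rw [e2]
    refine e1.trans ?_
    have e3 : ‖(u : ℂ) / b i‖ ^ 4 = u ^ 4 / ‖b i‖ ^ 4 := by
      rw [norm_div, div_pow, Complex.norm_real, Real.norm_eq_abs, ← abs_pow,
        abs_of_nonneg (by positivity)]
    rw [e3]
    calc K₀ * (u ^ 4 / ‖b i‖ ^ 4) ≤ K₀ * (u ^ 4 / β ^ 4) := by gcongr
      _ = K₀ / β ^ 4 * u ^ 4 := by ring
      _ ≤ K * u ^ 4 := by
        gcongr
        rw [hK]
        have : 0 < K₀ / β ^ 3 := by positivity
        linarith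
  have hmain := hlap φ (c / b i ^ 3) hφc hcK hexp N hN
  have hint : (∫ u in (-δ)..δ, Complex.exp (N * f i (z i + u / b i))) =
      Complex.exp (N * f i (z i)) * ∫ u in (-δ)..δ, Complex.exp (N * φ u) := by
    rw [← intervalIntegral.integral_const_mul]
    congr 1
    funext u
    rw [← Complex.exp_add, hφ]
    ring_nf
  rw [segmentIntegral_centered, hint, ← sub_div, ← mul_sub, norm_div, norm_mul, Complex.norm_exp,
    Complex.re_ofReal_mul, div_le_iff₀ (norm_pos_iff.2 hbi)]
  calc _ ≤ Real.exp (N * (f i (z i)).re) * (A / N * √(2 * Real.pi / N)) := by gcongr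
    _ = A / β / N * √(2 * Real.pi / N) * Real.exp (N * (f i (z i)).re) * β := by field_simp
    _ ≤ _ := by gcongr

/-- Puts these contributions into the form of the Laplace error, so that the two can be added. -/
theorem ExponentiallySmall.exists_bound {ι : Type*} {l : Filter ι} {m : ι → ℝ} {I : ι → ℝ → ℂ}
    (h : ExponentiallySmall l m I) :
    ∃ A > 0, ∀ᶠ i in l, ∀ N : ℝ, 1 ≤ N →
      ‖I i N‖ ≤ A / N * √(2 * Real.pi / N) * Real.exp (N * m i) := by
  obtain ⟨c, hc, K, hK, h⟩ := h
  refine ⟨2 * (K + 1) / c ^ 2, by positivity, ?_⟩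
  filter_upwards [h] with i hi N hN
  have hN0 : 0 < N := by linarith
  have h1 : Real.exp (-(c * N)) ≤ 2 / c ^ 2 / N * (1 / N) := by
    rw [Real.exp_neg]
    have := Real.pow_div_factorial_le_exp (c * N) (by positivity) 2
    calc (Real.exp (c * N))⁻¹ ≤ ((c * N) ^ 2 / Nat.factorial 2)⁻¹ := by gcongr
      _ = _ := by norm_num [Nat.factorial]; field_simp
  have h2 : 1 / N ≤ √(2 * Real.pi / N) := by
    refine Real.le_sqrt_of_sq_le ?_
    rw [div_pow, one_pow, div_le_div_iff₀ (by positivity) hN0, sq, one_mul]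
    have : 1 * N ≤ N * N := by gcongr
    have : 1 * (N * N) ≤ 2 * Real.pi * (N * N) := by
      gcongr
      linarith [Real.two_le_pi]
    linarith
  calc ‖I i N‖ ≤ K * Real.exp (N * (m i - c)) := hi N hN0.le
    _ = K * Real.exp (-(c * N)) * Real.exp (N * m i) := by
        rw [mul_assoc, ← Real.exp_add]; ring_nf
    _ ≤ (K + 1) * (2 / c ^ 2 / N * √(2 * Real.pi / N)) * Real.exp (N * m i) := by
        gcongr
        · linarith
        · exact h1.trans (by gcongr)
    _ = _ := by ring

/-! ### Assembling the deformed contour. -/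

/-- Times around the passage of a curve through `z₀` from left to right, close to the passage. -/
theorem exists_times_of_passesOnceLeftToRight {γ : ℝ → ℂ} {z : ℂ}
    (hγ : ContinuousOn γ (Icc 0 1)) (hpass : SaddlePoint.PassesOnceLeftToRight γ z)
    {p : ℂ → Prop} (hp : ∀ᶠ w in 𝓝 z, p w) :
    ∃ a b : ℝ, 0 ≤ a ∧ a ≤ b ∧ b ≤ 1 ∧ (∀ t ∈ Icc a b, p (γ t)) ∧ (γ a).re < z.re ∧
      z.re < (γ b).re ∧ (∀ t ∈ Icc 0 a, γ t ≠ z) ∧ ∀ t ∈ Icc b 1, γ t ≠ z := by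
  obtain ⟨t₀, ht₀, hz, huniq, hleft, hright⟩ := hpass
  have hcont : ContinuousAt γ t₀ := hγ.continuousAt (Icc_mem_nhds ht₀.1 ht₀.2)
  have h1 : ∀ᶠ t in 𝓝 t₀, p (γ t) := by
    rw [← hz] at hp
    exact hcont.eventually hp
  obtain ⟨ε, hε, hεp⟩ := Metric.eventually_nhds_iff.1 h1
  have h2 : ∀ᶠ a in 𝓝[<] t₀, a ∈ Ioo (max 0 (t₀ - ε)) t₀ :=
    Ioo_mem_nhdsLT (max_lt ht₀.1 (by linarith))
  have h3 : ∀ᶠ b in 𝓝[>] t₀, b ∈ Ioo t₀ (min 1 (t₀ + ε)) :=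
    Ioo_mem_nhdsGT (lt_min ht₀.2 (by linarith))
  obtain ⟨a, ha, haI⟩ := (hleft.and h2).exists
  obtain ⟨b, hb, hbI⟩ := (hright.and h3).exists
  have ha0 := (max_lt_iff.1 haI.1).1
  have haε := (max_lt_iff.1 haI.1).2
  have hb1 := (lt_min_iff.1 hbI.2).1
  have hbε := (lt_min_iff.1 hbI.2).2
  have hat := haI.2
  have hbt := hbI.1
  refine ⟨a, b, ha0.le, by linarith, hb1.le, fun t ht => hεp ?_, ha, hb, fun t ht h => ?_,
    fun t ht h => ?_⟩
  · rw [Real.dist_eq, abs_lt]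
    constructor <;> linarith [ht.1, ht.2]
  · have := huniq t ⟨ht.1, by linarith [ht.2]⟩ h
    linarith [ht.2]
  · have := huniq t ⟨by linarith [ht.1], ht.2⟩ h
    linarith [ht.1]

/-- The saddle point approximation for a convergent family of exponents and contours, with an
error bound that is uniform in the family. -/
theorem exists_saddle_point_bound {ι : Type*} {l : Filter ι} {f : ι → ℂ → ℂ} {f₀ : ℂ → ℂ}
    {U : Set ℂ} (hU : IsOpen U) (hf : ∀ᶠ i in l, DifferentiableOn ℂ (f i) U)
    (hlim : TendstoLocallyUniformlyOn f f₀ l U) (hf₀ : DifferentiableOn ℂ f₀ U)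
    {γ : ι → ℝ → ℂ} {γ₀ : ℝ → ℂ} (hγ : ∀ᶠ i in l, SaddlePoint.IsContour (γ i))
    (hγlim : TendstoUniformlyOn γ γ₀ l (Icc 0 1)) (hγ₀ : ContinuousOn γ₀ (Icc 0 1))
    (hγU : ∀ t ∈ Icc (0 : ℝ) 1, γ₀ t ∈ U) {z b : ι → ℂ} {z₀ b₀ : ℂ} (hz : Tendsto z l (𝓝 z₀))
    (hcrit : ∀ᶠ i in l, deriv (f i) (z i) = 0) (hb : Tendsto b l (𝓝 b₀))
    (hbf : ∀ᶠ i in l, b i ^ 2 = -deriv (deriv (f i)) (z i))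
    (hbf₀ : b₀ ^ 2 = -deriv (deriv f₀) z₀) (hb₀ : |b₀.im| < b₀.re)
    (hsaddle : ∀ t ∈ Icc (0 : ℝ) 1, deriv f₀ (γ₀ t) = 0 ↔ γ₀ t = z₀)
    (hmax : ∀ t ∈ Icc (0 : ℝ) 1, (f₀ (γ₀ t)).re ≤ (f₀ z₀).re)
    (hends : (γ₀ 0 = γ₀ 1 ∧ ∀ᶠ i in l, γ i 0 = γ i 1) ∨
      ((f₀ (γ₀ 0)).re < (f₀ z₀).re ∧ (f₀ (γ₀ 1)).re < (f₀ z₀).re))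
    (hpass : SaddlePoint.PassesOnceLeftToRight γ₀ z₀) :
    ∃ A > (0 : ℝ), ∀ᶠ i in l, ∀ N : ℝ, 1 ≤ N →
      ‖(∫ t in (0 : ℝ)..1, Complex.exp (N * f i (γ i t)) * deriv (γ i) t)
        - Complex.exp (N * f i (z i)) * (√(2 * Real.pi / N) : ℝ) / b i‖
      ≤ A / N * √(2 * Real.pi / N) * Real.exp (N * (f i (z i)).re) := by
  have hz₀Γ : z₀ ∈ γ₀ '' Icc 0 1 := by
    obtain ⟨t₀, ht₀, h, -⟩ := hpass
    exact ⟨t₀, Ioo_subset_Icc_self ht₀, h⟩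
  have hz₀U : z₀ ∈ U := by
    obtain ⟨t, ht, rfl⟩ := hz₀Γ
    exact hγU t ht
  have hcrit₀ : deriv f₀ z₀ = 0 := by
    obtain ⟨t, ht, h⟩ := hz₀Γ
    rw [← h]
    exact (hsaddle t ht).2 h
  have hb₀ne : b₀ ≠ 0 := by rintro rfl; simp at hb₀
  have hA0 : 0 < ‖b₀‖ ^ 2 := by have := norm_pos_iff.2 hb₀ne; positivity
  have hm : Tendsto (fun i => (f i (z i)).re) l (𝓝 (f₀ z₀).re) := by
    refine (Complex.continuous_re.tendsto _).comp (hlim.tendsto_comp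
      (hf₀.continuousOn z₀ hz₀U) hz₀U ?_)
    exact tendsto_nhdsWithin_iff.2 ⟨hz, hz.eventually (hU.mem_nhds hz₀U)⟩
  obtain ⟨ρ, hρ, K, hK, hΓ⟩ := exists_uniform_taylor_of_isCompact hU hf₀
    (isCompact_Icc.image_of_continuousOn hγ₀) (image_subset_iff.2 hγU)
  obtain ⟨K₁, hK₁, ρ₁, hρ₁, -, hT⟩ := exists_taylor_at_critical hU hz₀U hf₀ hcrit₀
  obtain ⟨s₁, hs₁, hsector⟩ := exists_segment_below_saddle (f := f₀) (z := z₀) (b := b₀)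
    (K := K₁) (ρ := min ρ₁ ρ) hK₁ (lt_min hρ₁ hρ) hb₀ fun w hw => by
      have := hT w (Metric.ball_subset_ball (min_le_left _ _) hw)
      rw [show deriv (deriv f₀) z₀ = -b₀ ^ 2 by rw [hbf₀, neg_neg]] at this
      convert this using 2
      ring
  set s := min s₁ (min (1 / (2 * K)) (ρ / (2 * K))) with hs
  have hs0 : 0 < s := by positivity
  have hsK : s * K ≤ 1 / 2 := by
    have := (min_le_right s₁ _).trans (min_le_left (1 / (2 * K)) (ρ / (2 * K)))
    rw [← hs, le_div_iff₀ (by positivity)] at this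
    linarith
  have hsρ : s * K ≤ ρ / 2 := by
    have := (min_le_right s₁ _).trans (min_le_right (1 / (2 * K)) (ρ / (2 * K)))
    rw [← hs, le_div_iff₀ (by positivity)] at this
    linarith
  obtain ⟨r, hr, hsec⟩ := hsector s ⟨hs0, min_le_left _ _⟩
  obtain ⟨δ₁, hδ₁, hcentral⟩ := exists_central_bound hU hf hlim hf₀.continuousOn hz₀U hz hb₀ne hb
    hcrit hbf
  set δ := min (min r δ₁) (ρ / 2 * ‖b₀‖) with hδ
  have hδ0 : 0 < δ := by have := norm_pos_iff.2 hb₀ne; positivity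
  have hδr : δ ∈ Ioc 0 r := ⟨hδ0, (min_le_left _ _).trans (min_le_left _ _)⟩
  obtain ⟨A₁, hA₁, hcen⟩ := hcentral δ ⟨hδ0, (min_le_left _ _).trans (min_le_right _ _)⟩
  -- the descent steps from the points of the curve
  have hdist : ∀ s' ∈ Icc 0 s, ∀ t ∈ Icc (0 : ℝ) 1,
      dist (descentStep f₀ s' (γ₀ t)) (γ₀ t) ≤ ρ / 2 := by
    intro s' hs' t ht
    rw [dist_descentStep f₀ hs'.1]
    have h1 := (hΓ (γ₀ t) ⟨t, ht, rfl⟩).2.1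
    have h2 : s' * ‖deriv f₀ (γ₀ t)‖ ≤ s * K :=
      mul_le_mul hs'.2 h1 (norm_nonneg _) hs0.le
    linarith
  have hball : ∀ t ∈ Icc (0 : ℝ) 1, Metric.ball (γ₀ t) ρ ⊆ U := fun t ht => (hΓ _ ⟨t, ht, rfl⟩).1
  have hstepball : ∀ s' ∈ Icc 0 s, ∀ t ∈ Icc (0 : ℝ) 1,
      descentStep f₀ s' (γ₀ t) ∈ Metric.ball (γ₀ t) ρ := fun s' hs' t ht =>
    Metric.mem_ball.2 ((hdist s' hs' t ht).trans_lt (by linarith))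
  have hstep : ∀ s' ∈ Icc 0 s, ∀ t ∈ Icc (0 : ℝ) 1, (f₀ (descentStep f₀ s' (γ₀ t))).re ≤
      (f₀ (γ₀ t)).re - s' / 2 * ‖deriv f₀ (γ₀ t)‖ ^ 2 := by
    intro s' hs' t ht
    refine re_descentStep_le (K := K) hs'.1 ?_
      ((hΓ _ ⟨t, ht, rfl⟩).2.2 _ (hstepball s' hs' t ht))
    have : s' * K ≤ s * K := by gcongr; exact hs'.2
    linarith
  have hsmem : s ∈ Icc 0 s := ⟨hs0.le, le_rfl⟩
  set Q : ℝ → ℂ := fun t => descentStep f₀ s (γ₀ t) with hQ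
  have hQc : ContinuousOn Q (Icc 0 1) := by
    have h1 : ContinuousOn (fun t => deriv f₀ (γ₀ t)) (Icc 0 1) :=
      (hf₀.deriv hU).continuousOn.comp hγ₀ hγU
    exact hγ₀.sub (continuousOn_const.mul (Complex.continuous_conj.comp_continuousOn h1))
  have hQle : ∀ t ∈ Icc (0 : ℝ) 1, (f₀ (Q t)).re ≤ (f₀ z₀).re - s / 2 * ‖deriv f₀ (γ₀ t)‖ ^ 2 :=
    fun t ht => (hstep s hsmem t ht).trans (by linarith [hmax t ht])
  have hQlt : ∀ t ∈ Icc (0 : ℝ) 1, γ₀ t ≠ z₀ → (f₀ (Q t)).re < (f₀ z₀).re := by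
    intro t ht hne
    have h1 : 0 < ‖deriv f₀ (γ₀ t)‖ := norm_pos_iff.2 fun h => hne ((hsaddle t ht).1 h)
    have h2 : 0 < s / 2 * ‖deriv f₀ (γ₀ t)‖ ^ 2 := by positivity
    linarith [hQle t ht]
  -- the times around the passage through the saddle point
  have hnear : ∀ᶠ w in 𝓝 z₀, ‖w - z₀‖ ≤ r ∧ dist w z₀ < ρ / 4 ∧
      ‖deriv f₀ w + b₀ ^ 2 * (w - z₀)‖ ≤ ‖b₀‖ ^ 2 / 2 * ‖w - z₀‖ := by
    have h1 := ((hf₀.deriv hU).differentiableAt (hU.mem_nhds hz₀U)).hasDerivAt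
    have h2 := (hasDerivAt_iff_isLittleO.1 h1).bound (show 0 < ‖b₀‖ ^ 2 / 2 by positivity)
    filter_upwards [h2, Metric.closedBall_mem_nhds z₀ hr,
      Metric.ball_mem_nhds z₀ (show 0 < ρ / 4 by positivity)] with w hw1 hw2 hw3
    refine ⟨by rwa [Metric.mem_closedBall, dist_eq_norm] at hw2, hw3, ?_⟩
    rw [hcrit₀, sub_zero, smul_eq_mul,
      show deriv (deriv f₀) z₀ = -b₀ ^ 2 by rw [hbf₀, neg_neg]] at hw1
    rwa [show deriv f₀ w - (w - z₀) * -b₀ ^ 2 = deriv f₀ w + b₀ ^ 2 * (w - z₀) by ring] at hw1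
  obtain ⟨tl, tr, htl, htlr, htr, hmid, hleft, hright, hnel, hner⟩ :=
    exists_times_of_passesOnceLeftToRight hγ₀ hpass hnear
  have htl' : tl ∈ Icc (0 : ℝ) 1 := ⟨htl, htlr.trans htr⟩
  have htr' : tr ∈ Icc (0 : ℝ) 1 := ⟨htl.trans htlr, htr⟩
  have hseg : ∀ t ∈ Icc tl tr, ∀ σ : ℝ, σ = 1 ∨ σ = -1 → 0 < σ * (γ₀ t - z₀).re →
      ∀ w ∈ segment ℝ (z₀ + σ * δ / b₀) (Q t), w ∈ Metric.ball z₀ (min ρ₁ ρ) ∧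
        (f₀ w).re < (f₀ z₀).re := by
    intro t ht σ hσ hσre
    have ht' : t ∈ Icc (0 : ℝ) 1 := ⟨htl.trans ht.1, ht.2.trans htr⟩
    obtain ⟨h1, -, h3⟩ := hmid t ht
    have h4 : ‖b₀ ^ 2 * (γ₀ t - z₀)‖ = ‖b₀‖ ^ 2 * ‖γ₀ t - z₀‖ := by rw [norm_mul, norm_pow]
    refine hsec δ hδr σ hσ (γ₀ t) (Q t) (deriv f₀ (γ₀ t)) h1 hσre ?_ ?_ ?_ (hQle t ht')
    · have := norm_sub_le (deriv f₀ (γ₀ t) + b₀ ^ 2 * (γ₀ t - z₀)) (deriv f₀ (γ₀ t))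
      rw [add_sub_cancel_left, h4] at this
      linarith
    · have := norm_sub_le (deriv f₀ (γ₀ t) + b₀ ^ 2 * (γ₀ t - z₀)) (b₀ ^ 2 * (γ₀ t - z₀))
      rw [add_sub_cancel_right, h4] at this
      have : 0 ≤ ‖b₀‖ ^ 2 * ‖γ₀ t - z₀‖ := by positivity
      linarith
    · simp only [hQ, descentStep]
      ring
  have hsubU : Metric.ball z₀ ρ ⊆ U := (hΓ z₀ hz₀Γ).1
  have hsubU' : Metric.ball z₀ (min ρ₁ ρ) ⊆ U :=
    (Metric.ball_subset_ball (min_le_right _ _)).trans hsubU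
  have hplim : ∀ σ : ℝ, Tendsto (fun i => z i + σ * δ / b i) l (𝓝 (z₀ + σ * δ / b₀)) :=
    fun σ => hz.add (tendsto_const_nhds.div hb hb₀ne)
  -- the exponentially small contributions
  have E₁ := exponentiallySmall_deformedIntegral hU hf hlim hf₀.continuousOn hm hγ hγlim hγ₀
    le_rfl htl htl'.2 hρ (fun t ht => hball t ⟨ht.1, ht.2.trans htl'.2⟩)
    (hQc.mono (Icc_subset_Icc_right htl'.2))
    (fun t ht => hstepball s hsmem t ⟨ht.1, ht.2.trans htl'.2⟩)
    fun t ht => hQlt t ⟨ht.1, ht.2.trans htl'.2⟩ (hnel t ht)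
  have E₂ := exponentiallySmall_deformedIntegral hU hf hlim hf₀.continuousOn hm hγ hγlim hγ₀
    htr'.1 htr le_rfl hρ (fun t ht => hball t ⟨htr'.1.trans ht.1, ht.2⟩)
    (hQc.mono (Icc_subset_Icc_left htr'.1))
    (fun t ht => hstepball s hsmem t ⟨htr'.1.trans ht.1, ht.2⟩)
    fun t ht => hQlt t ⟨htr'.1.trans ht.1, ht.2⟩ (hner t ht)
  have E₃ := exponentiallySmall_segmentIntegral hU hlim hf₀.continuousOn hm (hplim (-1))
    (p := fun _ => Q tl) tendsto_const_nhds fun w hw => by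
      obtain ⟨h1, h2⟩ := hseg tl ⟨le_rfl, htlr⟩ (-1) (Or.inr rfl)
        (by rw [Complex.sub_re]; linarith) w hw
      exact ⟨hsubU' h1, h2⟩
  have E₄ := exponentiallySmall_segmentIntegral hU hlim hf₀.continuousOn hm (hplim 1)
    (p := fun _ => Q tr) tendsto_const_nhds fun w hw => by
      obtain ⟨h1, h2⟩ := hseg tr ⟨htlr, le_rfl⟩ 1 (Or.inl rfl)
        (by rw [Complex.sub_re]; linarith) w hw
      exact ⟨hsubU' h1, h2⟩
  have hγt : ∀ t ∈ Icc (0 : ℝ) 1, Tendsto (fun i => γ i t) l (𝓝 (γ₀ t)) :=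
    fun t ht => hγlim.tendsto_at ht
  have E₅ : ExponentiallySmall l (fun i => (f i (z i)).re) fun i N =>
      segmentIntegral (fun w => Complex.exp (N * f i w)) (Q 1) (γ i 1) +
        -segmentIntegral (fun w => Complex.exp (N * f i w)) (Q 0) (γ i 0) := by
    -- For loops the two end segments coincide and cancel. For arcs each is close to a path of
    -- partial descent steps from an end that already lies below the maximum.
    rcases hends with ⟨h0, h⟩ | ⟨h0, h1⟩
    · refine ExponentiallySmall.zero.congr ?_
      filter_upwards [h] with i hi N
      rw [hi, hQ]
      simp only [h0]
      ring
    · have hend : ∀ t ∈ Icc (0 : ℝ) 1, (f₀ (γ₀ t)).re < (f₀ z₀).re →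
          ExponentiallySmall l (fun i => (f i (z i)).re) fun i N =>
            segmentIntegral (fun w => Complex.exp (N * f i w)) (Q t) (γ i t) := by
        intro t ht hlt
        refine exponentiallySmall_segmentIntegral hU hlim hf₀.continuousOn hm (q := fun _ => Q t)
          tendsto_const_nhds (hγt t ht) fun w hw => ?_
        rw [segment_symm, segment_eq_image'] at hw
        obtain ⟨θ, hθ, rfl⟩ := hw
        have e : γ₀ t + θ • (Q t - γ₀ t) = descentStep f₀ (θ * s) (γ₀ t) := by
          simp only [hQ, descentStep, Complex.real_smul]
          push_cast
          ring
        have hθs : θ * s ∈ Icc 0 s :=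
          ⟨mul_nonneg hθ.1 hs0.le, mul_le_of_le_one_left hs0.le hθ.2⟩
        simp only [e]
        refine ⟨hball t ht (hstepball _ hθs t ht), (hstep _ hθs t ht).trans_lt ?_⟩
        have : 0 ≤ θ * s / 2 * ‖deriv f₀ (γ₀ t)‖ ^ 2 :=
          mul_nonneg (by linarith [hθs.1]) (sq_nonneg _)
        linarith
      exact (hend 1 ⟨zero_le_one, le_rfl⟩ h1).add (hend 0 ⟨le_rfl, zero_le_one⟩ h0).neg
  obtain ⟨A₂, hA₂, hrest⟩ := (((E₁.add E₂).add (E₃.neg.add E₄)).add E₅).exists_bound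
  refine ⟨A₁ + A₂, by positivity, ?_⟩
  have hpball : ∀ σ : ℝ, σ = 1 ∨ σ = -1 → ∀ᶠ i in l, z i + σ * δ / b i ∈ Metric.ball z₀ ρ := by
    intro σ hσ
    have hσabs : |σ| = 1 := by rcases hσ with rfl | rfl <;> norm_num
    refine (hplim σ).eventually (Metric.isOpen_ball.mem_nhds ?_)
    rw [Metric.mem_ball, dist_eq_norm, add_sub_cancel_left, norm_div, norm_mul, Complex.norm_real,
      Complex.norm_real, Real.norm_eq_abs, hσabs, one_mul, Real.norm_of_nonneg hδ0.le,
      div_lt_iff₀ (norm_pos_iff.2 hb₀ne)]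
    have h1 : δ ≤ ρ / 2 * ‖b₀‖ := min_le_right _ _
    have h2 : 0 < ρ / 2 * ‖b₀‖ := by have := norm_pos_iff.2 hb₀ne; positivity
    linarith
  have hQball : ∀ t ∈ Icc tl tr, Q t ∈ Metric.ball z₀ ρ := by
    intro t ht
    have h1 := hdist s hsmem t ⟨htl.trans ht.1, ht.2.trans htr⟩
    have h2 := (hmid t ht).2.1
    rw [Metric.mem_ball]
    linarith [dist_triangle (Q t) (γ₀ t) z₀]
  have hγU' : ∀ᶠ i in l, ∀ t ∈ Icc (0 : ℝ) 1, dist (γ₀ t) (γ i t) < ρ / 4 :=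
    Metric.tendstoUniformlyOn_iff.1 hγlim _ (by positivity)
  filter_upwards [hcen, hrest, hf, hγ, hγU', hpball 1 (Or.inl rfl), hpball (-1) (Or.inr rfl)]
    with i h1 h2 hfi hγi h3 h4 h5 N hN
  obtain ⟨hc, G, hG⟩ := exists_primitive_exp (hfi.mono hsubU) N
  have hconv := convex_ball z₀ ρ
  have hγUi : ∀ t ∈ Icc (0 : ℝ) 1, γ i t ∈ U := by
    intro t ht
    refine hball t ht ?_
    rw [Metric.mem_ball, dist_comm]
    linarith [h3 t ht]
  have hQl := hQball tl ⟨le_rfl, htlr⟩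
  have hQr := hQball tr ⟨htlr, le_rfl⟩
  have hdef := deformedIntegral_eq_segmentIntegral (Q := Q) (hfi.mono hsubU) hγi htl htlr htr
    (fun t ht => by
      rw [Metric.mem_ball]
      have e1 := h3 t ⟨htl.trans ht.1, ht.2.trans htr⟩
      have e2 := (hmid t ht).2.1
      rw [dist_comm] at e1
      linarith [dist_triangle (γ i t) (γ₀ t) z₀]) hQl hQr N
  have hadd1 := deformedIntegral_add (Q := Q) hfi.continuousOn hγi le_rfl htl htlr htr'.2
    (fun t ht => hγUi t ⟨ht.1, ht.2.trans htr⟩) N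
  have hadd2 := deformedIntegral_add (Q := Q) hfi.continuousOn hγi le_rfl htr'.1 htr le_rfl
    hγUi N
  have hm1 : z i + ((-1 : ℝ) : ℂ) * δ / b i = z i - δ / b i := by push_cast; ring
  have hm2 : z i + ((1 : ℝ) : ℂ) * δ / b i = z i + δ / b i := by push_cast; ring
  have h1' := h1 N hN
  have h2' := h2 N hN
  rw [hm1] at h5 h2'
  rw [hm2] at h4 h2'
  -- Cauchy's theorem in the disk about `z₀`: the path from `Q tl` to `Q tr` is led through both
  -- ends of the central segment.
  have hsplit : segmentIntegral (fun w => Complex.exp (N * f i w)) (Q tl) (Q tr) =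
      -segmentIntegral (fun w => Complex.exp (N * f i w)) (z i - δ / b i) (Q tl) +
      segmentIntegral (fun w => Complex.exp (N * f i w)) (z i - δ / b i) (z i + δ / b i) +
      segmentIntegral (fun w => Complex.exp (N * f i w)) (z i + δ / b i) (Q tr) := by
    rw [segmentIntegral_eq_sub hconv hG hc hQl hQr, segmentIntegral_eq_sub hconv hG hc h5 hQl,
      segmentIntegral_eq_sub hconv hG hc h5 h4, segmentIntegral_eq_sub hconv hG hc h4 hQr]
    ring
  have htotal : (∫ t in (0 : ℝ)..1, Complex.exp (N * f i (γ i t)) * deriv (γ i) t) =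
      deformedIntegral (f i) (γ i) Q 0 1 N +
      (segmentIntegral (fun w => Complex.exp (N * f i w)) (Q 1) (γ i 1) +
        -segmentIntegral (fun w => Complex.exp (N * f i w)) (Q 0) (γ i 0)) := by
    rw [deformedIntegral]; ring
  rw [htotal, ← hadd2, ← hadd1, hdef, hsplit]
  refine le_trans (le_of_eq ?_) ((norm_add_le _ _).trans (add_le_add h1' h2')) |>.trans
    (le_of_eq (by ring))
  congr 1
  ring

/-! ### Convergence of the family and the principal square root. -/

theorem sq_sqrt_complex (a : ℂ) : Complex.sqrt a ^ 2 = a :=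
  Complex.cpow_ofNat_inv_pow a 2

theorem abs_im_lt_re_of_abs_arg_lt {b : ℂ} (hb : b ≠ 0) (h : |b.arg| < Real.pi / 4) :
    |b.im| < b.re := by
  have hn : 0 < ‖b‖ := norm_pos_iff.2 hb
  rw [← Complex.norm_mul_sin_arg b, ← Complex.norm_mul_cos_arg b, abs_mul, abs_norm]
  refine mul_lt_mul_of_pos_left ?_ hn
  have hpi := Real.pi_pos
  have h0 := abs_nonneg b.arg
  rw [← Real.cos_abs b.arg, Real.abs_sin_eq_sin_abs_of_abs_le_pi (by linarith)]
  have h1 : Real.sin |b.arg| < Real.sin (Real.pi / 4) :=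
    Real.sin_lt_sin_of_lt_of_le_pi_div_two (by linarith) (by linarith) h
  have h2 : Real.cos (Real.pi / 4) < Real.cos |b.arg| :=
    Real.cos_lt_cos_of_nonneg_of_le_pi_div_two h0 (by linarith) h
  rw [Real.sin_pi_div_four] at h1
  rw [Real.cos_pi_div_four] at h2
  linarith

/-- Members of a smooth holomorphic family converge locally uniformly, on a common
neighbourhood of a compact set. -/
theorem SaddlePoint.IsSmoothHolomorphicFamily.exists_tendstoLocallyUniformlyOn {ι : Type*}
    {l : Filter ι} {D : ℝ → Set ℂ} {Φ : ℝ → ℂ → ℂ}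
    (hΦ : SaddlePoint.IsSmoothHolomorphicFamily D Φ) {y : ι → ℝ} (hy : ∀ i, y i ∈ Icc (0 : ℝ) 1)
    {y₀ : ℝ} (hy₀ : y₀ ∈ Icc (0 : ℝ) 1) (hlim : Tendsto y l (𝓝 y₀)) {Γ : Set ℂ}
    (hΓ : IsCompact Γ) (hΓD : Γ ⊆ D y₀) :
    ∃ U, IsOpen U ∧ Γ ⊆ U ∧ U ⊆ D y₀ ∧ (∀ᶠ i in l, U ⊆ D (y i)) ∧
      TendstoLocallyUniformlyOn (fun i => Φ (y i)) (Φ y₀) l U := by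
  obtain ⟨O, hO, hDO⟩ := hΦ.relatively_open
  have hD₀ : IsOpen (D y₀) := by
    have : D y₀ = (fun w => (y₀, w)) ⁻¹' O := ext fun w => hDO y₀ hy₀ w
    rw [this]
    exact hO.preimage (by fun_prop)
  obtain ⟨η, hη, hT⟩ := hΓ.exists_cthickening_subset_open hD₀ hΓD
  have hthick := Metric.thickening_subset_cthickening η Γ
  -- Tube lemma: nearby domains all contain a fixed neighbourhood of the compact set.
  have htube : ∀ᶠ x in 𝓝 y₀, ∀ w ∈ Metric.cthickening η Γ, (x, w) ∈ O :=
    hΓ.cthickening.eventually_forall_of_forall_eventually fun w hw =>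
      hO.mem_nhds ((hDO y₀ hy₀ w).1 (hT hw))
  have hUD : ∀ᶠ i in l, Metric.thickening η Γ ⊆ D (y i) := by
    filter_upwards [hlim.eventually htube] with i hi w hw
    exact (hDO _ (hy i) w).2 (hi w (hthick hw))
  refine ⟨Metric.thickening η Γ, Metric.isOpen_thickening, Metric.self_subset_thickening hη Γ,
    hthick.trans hT, hUD, ?_⟩
  rw [Metric.tendstoLocallyUniformlyOn_iff]
  intro ε hε w hw
  obtain ⟨d, hd, hcont⟩ := Metric.continuousWithinAt_iff.1
    (hΦ.smooth.continuousOn (y₀, w) ⟨hy₀, hT (hthick hw)⟩) (ε / 2) (by positivity)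
  refine ⟨Metric.thickening η Γ ∩ Metric.ball w d,
    inter_mem self_mem_nhdsWithin (mem_nhdsWithin_of_mem_nhds (Metric.ball_mem_nhds w hd)), ?_⟩
  filter_upwards [hUD, hlim.eventually (Metric.ball_mem_nhds y₀ hd)] with i hi hyi v hv
  have h1 := hcont (x := (y₀, v)) ⟨hy₀, hT (hthick hv.1)⟩ (by
    rw [Prod.dist_eq, dist_self]; exact max_lt hd hv.2)
  have h2 := hcont (x := (y i, v)) ⟨hy i, hi hv.1⟩ (by
    rw [Prod.dist_eq]; exact max_lt hyi hv.2)
  simp only at h1 h2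
  rw [dist_comm] at h2
  linarith [dist_triangle (Φ y₀ v) (Φ y₀ w) (Φ (y i) v)]

theorem tendstoUniformlyOn_curve {ι : Type*} {l : Filter ι} {C : ℝ → ℝ → ℂ}
    (hC : ContinuousOn (fun p : ℝ × ℝ => C p.1 p.2) (Icc (0 : ℝ) 1 ×ˢ Icc (0 : ℝ) 1))
    {y : ι → ℝ} (hy : ∀ i, y i ∈ Icc (0 : ℝ) 1) {y₀ : ℝ} (hy₀ : y₀ ∈ Icc (0 : ℝ) 1)
    (hlim : Tendsto y l (𝓝 y₀)) :
    TendstoUniformlyOn (fun i => C (y i)) (C y₀) l (Icc 0 1) := by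
  have hu := (isCompact_Icc.prod isCompact_Icc).uniformContinuousOn_of_continuous hC
  rw [Metric.uniformContinuousOn_iff] at hu
  rw [Metric.tendstoUniformlyOn_iff]
  intro ε hε
  obtain ⟨d, hd, h⟩ := hu ε hε
  filter_upwards [hlim.eventually (Metric.ball_mem_nhds y₀ hd)] with i hi t ht
  refine h (y₀, t) ⟨hy₀, ht⟩ (y i, t) ⟨hy i, ht⟩ ?_
  rw [Prod.dist_eq, dist_self, dist_comm]
  exact max_lt hi hd

/-- Zeros of `g i` on the curves `γ i` converge to the only zero of the limit on the limit
curve. -/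
theorem tendsto_zero_on_curve {ι : Type*} {l : Filter ι} {g : ι → ℂ → ℂ} {g₀ : ℂ → ℂ} {U : Set ℂ}
    (hU : IsOpen U) (hlim : TendstoLocallyUniformlyOn g g₀ l U) (hg₀ : ContinuousOn g₀ U)
    {γ : ι → ℝ → ℂ} {γ₀ : ℝ → ℂ} (hγlim : TendstoUniformlyOn γ γ₀ l (Icc 0 1))
    (hγ₀ : ContinuousOn γ₀ (Icc 0 1)) (hγU : ∀ t ∈ Icc (0 : ℝ) 1, γ₀ t ∈ U) {z : ι → ℂ} {z₀ : ℂ}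
    (huniq : ∀ t ∈ Icc (0 : ℝ) 1, g₀ (γ₀ t) = 0 → γ₀ t = z₀)
    (hz : ∀ i, ∃ t ∈ Icc (0 : ℝ) 1, γ i t = z i) (hgz : ∀ i, g i (z i) = 0) :
    Tendsto z l (𝓝 z₀) := by
  choose t ht htz using hz
  -- Along an ultrafilter the times converge to some τ by compactness. In the limit `γ₀ τ` is a zero
  -- of `g₀`, hence equals `z₀`.
  rw [tendsto_iff_ultrafilter]
  intro u hu
  obtain ⟨τ, hτ, hlimτ⟩ := isCompact_Icc.ultrafilter_le_nhds (u.map t)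
    (le_principal_iff.2 (Filter.mem_map.2 (Filter.univ_mem' ht)))
  have hτ' : Tendsto t u (𝓝[Icc 0 1] τ) :=
    tendsto_nhdsWithin_iff.2 ⟨hlimτ, Filter.Eventually.of_forall ht⟩
  have hγu : TendstoUniformlyOn γ γ₀ u (Icc 0 1) := fun v hv => (hγlim v hv).filter_mono hu
  have h1 : Tendsto (fun i => γ i (t i)) u (𝓝 (γ₀ τ)) := hγu.tendsto_comp (hγ₀ τ hτ) hτ'
  simp only [htz] at h1
  have hgu : TendstoLocallyUniformlyOn g g₀ u U := fun v hv x hx => by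
    obtain ⟨s, hs, h⟩ := hlim v hv x hx
    exact ⟨s, hs, h.filter_mono hu⟩
  have h2 : Tendsto (fun i => g i (z i)) u (𝓝 (g₀ (γ₀ τ))) :=
    hgu.tendsto_comp (hg₀ _ (hγU τ hτ)) (hγU τ hτ)
      (tendsto_nhdsWithin_iff.2 ⟨h1, h1.eventually (hU.mem_nhds (hγU τ hτ))⟩)
  simp only [hgz] at h2
  rwa [← huniq τ hτ (tendsto_nhds_unique h2 tendsto_const_nhds)]

/-- With Re b > 0 the quotient on the right has positive real part, so it is the principal root of
its square. -/
theorem sqrt_div_mul_sq {N : ℝ} (hN : 0 < N) {b : ℂ} (hb : 0 < b.re) :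
    Complex.sqrt (2 * Real.pi / (N * b ^ 2)) = (√(2 * Real.pi / N) : ℝ) / b := by
  have h : (2 * Real.pi / (N * b ^ 2) : ℂ) = ((√(2 * Real.pi / N) : ℝ) / b) ^ 2 := by
    rw [div_pow, ← Complex.ofReal_pow, Real.sq_sqrt (by positivity)]
    push_cast
    rw [div_div]
  rw [h, Complex.sqrt]
  refine Complex.sq_cpow_two_inv ?_
  have hbn : 0 < Complex.normSq b := Complex.normSq_pos.2 (by rintro rfl; simp at hb)
  rw [div_eq_mul_inv, Complex.re_ofReal_mul, Complex.inv_re]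
  have : 0 < √(2 * Real.pi / N) := by positivity
  positivity

theorem theorem2p3
    (D : ℝ → Set ℂ) (Φ : ℝ → ℂ → ℂ) (C : ℝ → ℝ → ℂ) (z : ℝ → ℂ) (L : ℝ)
    -- holomorphic functions `Φ y` on `D y`, smoothly depending on `y ∈ [0,1]`
    (hΦ : SaddlePoint.IsSmoothHolomorphicFamily D Φ)
    -- a continuous family of contours of length at most `L`, lying in the domains
    (hC : ContinuousOn (fun p : ℝ × ℝ => C p.1 p.2) (Icc (0 : ℝ) 1 ×ˢ Icc (0 : ℝ) 1))
    (hcontour : ∀ y ∈ Icc (0 : ℝ) 1, SaddlePoint.IsContour (C y))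
    (hlength : ∀ y ∈ Icc (0 : ℝ) 1, SaddlePoint.contourLength (C y) ≤ L)
    (hCD : ∀ y ∈ Icc (0 : ℝ) 1, ∀ t ∈ Icc (0 : ℝ) 1, C y t ∈ D y)
    -- `z y` lies on the contour and is the only saddle point of `Φ y` there
    (hz : ∀ y ∈ Icc (0 : ℝ) 1, ∃ t ∈ Icc (0 : ℝ) 1, C y t = z y)
    (hsaddle : ∀ y ∈ Icc (0 : ℝ) 1, ∀ t ∈ Icc (0 : ℝ) 1,
      deriv (Φ y) (C y t) = 0 ↔ C y t = z y)
    -- the maximum of `Re Φ y` along the contour is attained at `z y`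
    (hmax : ∀ y ∈ Icc (0 : ℝ) 1, ∀ t ∈ Icc (0 : ℝ) 1,
      (Φ y (C y t)).re ≤ (Φ y (z y)).re)
    -- the contours are loops, or arcs that for `y = 0` start and end strictly below the maximum
    (hends : (∀ y ∈ Icc (0 : ℝ) 1, C y 0 = C y 1) ∨
      ((Φ 0 (C 0 0)).re < (Φ 0 (z 0)).re ∧ (Φ 0 (C 0 1)).re < (Φ 0 (z 0)).re))
    -- the contour `C 0` passes through the saddle point, once and from left to right
    (hpass : SaddlePoint.PassesOnceLeftToRight (C 0) (z 0))
    -- the second derivative at the saddle point, for `y = 0`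
    (hne : deriv (deriv (Φ 0)) (z 0) ≠ 0)
    (harg : |(Complex.sqrt (-deriv (deriv (Φ 0)) (z 0))).arg| < Real.pi / 4)
    (y : ℕ → ℝ) (hy : ∀ N, y N ∈ Icc (0 : ℝ) 1) (hy0 : Tendsto y atTop (𝓝 0)) :
    ∃ E : ℕ → ℂ, E =O[atTop] (fun N : ℕ => 1 / (N : ℝ)) ∧
      ∀ᶠ N : ℕ in atTop,
        deriv (deriv (Φ (y N))) (z (y N)) ≠ 0 ∧
        SaddlePoint.contourIntegral (fun w => Complex.exp (N * Φ (y N) w)) (C (y N)) =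
          Complex.sqrt (2 * Real.pi / (N * (-deriv (deriv (Φ (y N))) (z (y N))))) *
            Complex.exp (N * Φ (y N) (z (y N))) * (1 + E N) := by
  have h0 : (0 : ℝ) ∈ Icc (0 : ℝ) 1 := ⟨le_rfl, zero_le_one⟩
  have hC0 : ContinuousOn (C 0) (Icc 0 1) := (hcontour 0 h0).continuousOn
  obtain ⟨U, hU, hΓU, hUD, hUDN, hlim⟩ := hΦ.exists_tendstoLocallyUniformlyOn hy h0 hy0
    (isCompact_Icc.image_of_continuousOn hC0) (image_subset_iff.2 (hCD 0 h0))
  have hγU : ∀ t ∈ Icc (0 : ℝ) 1, C 0 t ∈ U := fun t ht => hΓU ⟨t, ht, rfl⟩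
  have hf₀ : DifferentiableOn ℂ (Φ 0) U := (hΦ.holomorphic 0 h0).mono hUD
  have hf : ∀ᶠ N in atTop, DifferentiableOn ℂ (Φ (y N)) U := by
    filter_upwards [hUDN] with N hN
    exact (hΦ.holomorphic _ (hy N)).mono hN
  have hγlim := tendstoUniformlyOn_curve hC hy h0 hy0
  have hcrit : ∀ N, deriv (Φ (y N)) (z (y N)) = 0 := by
    intro N
    obtain ⟨t, ht, h⟩ := hz _ (hy N)
    rw [← h]
    exact (hsaddle _ (hy N) t ht).2 h
  -- Weierstrass: locally uniform convergence of holomorphic functions passes to derivatives, here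
  -- used twice.
  have hlim1 := hlim.deriv hf hU
  have hf1 : ∀ᶠ N in atTop, DifferentiableOn ℂ ((deriv ∘ fun N => Φ (y N)) N) U :=
    hf.mono fun N hN => hN.deriv hU
  have hlim2 := hlim1.deriv hf1 hU
  have hzlim : Tendsto (fun N => z (y N)) atTop (𝓝 (z 0)) :=
    tendsto_zero_on_curve hU hlim1 (hf₀.deriv hU).continuousOn hγlim hC0 hγU
      (fun t ht => (hsaddle 0 h0 t ht).1) (fun N => hz _ (hy N)) hcrit
  have hz0U : z 0 ∈ U := by
    obtain ⟨t, ht, h⟩ := hz 0 h0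
    exact h ▸ hγU t ht
  have halim : Tendsto (fun N => deriv (deriv (Φ (y N))) (z (y N))) atTop
      (𝓝 (deriv (deriv (Φ 0)) (z 0))) :=
    hlim2.tendsto_comp (((hf₀.deriv hU).deriv hU).continuousOn _ hz0U) hz0U
      (tendsto_nhdsWithin_iff.2 ⟨hzlim, hzlim.eventually (hU.mem_nhds hz0U)⟩)
  set b : ℕ → ℂ := fun N => Complex.sqrt (-deriv (deriv (Φ (y N))) (z (y N))) with hb
  set b₀ : ℂ := Complex.sqrt (-deriv (deriv (Φ 0)) (z 0)) with hb₀
  have hbsq : ∀ N, b N ^ 2 = -deriv (deriv (Φ (y N))) (z (y N)) := fun N => sq_sqrt_complex _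
  have hb₀sq : b₀ ^ 2 = -deriv (deriv (Φ 0)) (z 0) := sq_sqrt_complex _
  have hb₀ne : b₀ ≠ 0 := by
    intro h
    rw [h, zero_pow two_ne_zero, eq_comm, neg_eq_zero] at hb₀sq
    exact hne hb₀sq
  have hb₀re : |b₀.im| < b₀.re := abs_im_lt_re_of_abs_arg_lt hb₀ne harg
  have hblim : Tendsto b atTop (𝓝 b₀) := by
    -- Since |Im b₀| < Re b₀, the limit b₀² has positive real part and so avoids the branch cut.
    refine (Complex.differentiableAt_sqrt ?_).continuousAt.tendsto.comp halim.neg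
    rw [← hb₀sq, Complex.mem_slitPlane_iff, re_sq]
    left
    have := sq_lt_sq.2 (hb₀re.trans_le (le_abs_self _))
    linarith
  obtain ⟨A, hA, hbound⟩ := exists_saddle_point_bound hU hf hlim hf₀
    (Filter.Eventually.of_forall fun N => hcontour _ (hy N)) hγlim hC0 hγU hzlim
    (Filter.Eventually.of_forall hcrit) hblim (Filter.Eventually.of_forall hbsq) hb₀sq hb₀re
    (hsaddle 0 h0) (hmax 0 h0)
    (hends.imp_left fun h => ⟨h 0 h0, Filter.Eventually.of_forall fun N => h _ (hy N)⟩) hpass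
  have hbre : ∀ᶠ N in atTop, 0 < (b N).re :=
    ((Complex.continuous_re.tendsto b₀).comp hblim).eventually
      (lt_mem_nhds ((abs_nonneg _).trans_lt hb₀re))
  set J : ℕ → ℂ := fun N =>
    SaddlePoint.contourIntegral (fun w => Complex.exp (N * Φ (y N) w)) (C (y N)) with hJ
  set T : ℕ → ℂ := fun N =>
    Complex.exp (N * Φ (y N) (z (y N))) * (√(2 * Real.pi / N) : ℝ) / b N with hT
  have hTne : ∀ᶠ N in atTop, T N ≠ 0 := by
    filter_upwards [hbre, eventually_ge_atTop 1] with N h1 hN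
    have hN0 : (0 : ℝ) < N := by exact_mod_cast hN
    have h2 : 0 < √(2 * Real.pi / N) := by positivity
    have h3 : b N ≠ 0 := by intro h; rw [h] at h1; simp at h1
    exact div_ne_zero (mul_ne_zero (Complex.exp_ne_zero _) (Complex.ofReal_ne_zero.2 h2.ne')) h3
  -- The error is defined by the formula itself; the content is its bound A‖b N‖/N.
  refine ⟨fun N => (J N - T N) / T N, ?_, ?_⟩
  · refine IsBigO.of_bound (A * (‖b₀‖ + 1)) ?_
    filter_upwards [hbound, hTne, hbre, eventually_ge_atTop 1,
      hblim.norm.eventually (gt_mem_nhds (lt_add_one ‖b₀‖))] with N h1 h2 h3 hN h4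
    have hN1 : (1 : ℝ) ≤ N := by exact_mod_cast hN
    have hN0 : (0 : ℝ) < N := by linarith
    -- The uniform bound treats the index of the family and the large parameter as independent; here
    -- both equal N.
    have h5 := h1 N hN1
    have h6 : b N ≠ 0 := by intro h; rw [h] at h3; simp at h3
    have h7 : ‖T N‖ = Real.exp (N * (Φ (y N) (z (y N))).re) * √(2 * Real.pi / N) / ‖b N‖ := by
      simp only [hT]
      rw [norm_div, norm_mul, Complex.norm_exp, Complex.norm_real,
        Real.norm_of_nonneg (Real.sqrt_nonneg _), ← Complex.ofReal_natCast, Complex.re_ofReal_mul]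
    have h8 : ‖J N - T N‖ ≤
        A / N * √(2 * Real.pi / N) * Real.exp (N * (Φ (y N) (z (y N))).re) := by
      simpa only [Complex.ofReal_natCast, hJ, hT, SaddlePoint.contourIntegral] using h5
    rw [norm_div, div_le_iff₀ (norm_pos_iff.2 h2), h7, norm_div, norm_one, Real.norm_of_nonneg hN0.le]
    refine h8.trans ?_
    have h9 : 0 < ‖b N‖ := norm_pos_iff.2 h6
    calc A / N * √(2 * Real.pi / N) * Real.exp (N * (Φ (y N) (z (y N))).re)
        = A * ‖b N‖ * (1 / N) *
          (Real.exp (N * (Φ (y N) (z (y N))).re) * √(2 * Real.pi / N) / ‖b N‖) := by field_simp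
      _ ≤ _ := by gcongr
  · filter_upwards [hTne, hbre, eventually_ge_atTop 1] with N h1 h2 hN
    have hN0 : (0 : ℝ) < N := by exact_mod_cast hN
    refine ⟨fun h => ?_, ?_⟩
    · have h3 := hbsq N
      rw [h, neg_zero, sq_eq_zero_iff] at h3
      rw [h3] at h2
      simp at h2
    · have h3 : Complex.sqrt (2 * Real.pi / (N * (-deriv (deriv (Φ (y N))) (z (y N))))) *
          Complex.exp (N * Φ (y N) (z (y N))) = T N := by
        rw [← hbsq N, ← Complex.ofReal_natCast N, sqrt_div_mul_sq hN0 h2]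
        simp only [hT, Complex.ofReal_natCast]
        ring
      rw [h3, mul_add, mul_one, mul_div_cancel₀ _ h1]
      exact (add_sub_cancel _ _).symm
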